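/- Let $X$ be a compact connected Riemann surface, $(V,\phi)$ a holomorphic Lie algebroid on $X$ (a holomorphic vector bundle $V$ with a $\mathbb C$-bilinear Lie bracket on its sheaf of sections and an $\mathcal O_X$-linear anchor $\phi:V\to TX$ such that $\phi([s,t])=[\phi(s),\phi(t)]$ and $[fs,t]=f[s,t]-\phi(t)(f)\,s$), and $E$ a holomorphic vector bundle on $X$. A Lie algebroid connection on $E$ is a $\mathbb C$-linear homomorphism of sheaves (a first order holomorphic differential operator) $D:E\to E\otimes V^*$ with $D(fs)=f\,D(s)+s\otimes\phi^*(df)$ for all local holomorphic sections $s$ of $E$ and local holomorphic functions $f$, where $\phi^*:K_X\to V^*$ is the dual of $\phi$. Let $J^1(E)$ be the first jet bundle, with $\alpha:E\otimes K_X\to J^1(E)$ given on fibres by $s(x)\otimes df_x\mapsto j^1_x(fs)$ when $f(x)=0$, and evaluation $\beta:J^1(E)\to E$. Put $$J^1_V(E)=\big((E\otimes V^*)\oplus J^1(E)\big)/\Delta(E\otimes K_X),\qquad \Delta(e\otimes w)=(-e\otimes\phi^*(w),\ \alpha(e\otimes w)).$$ Let $\alpha':E\otimes V^*\to J^1_V(E)$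 be induced by the inclusion of the first summand and $\beta':J^1_V(E)\to E$ by $\beta$. (1) The sequence $0\to E\otimes V^*\xrightarrow{\alpha'}J^1_V(E)\xrightarrow{\beta'}E\to0$ is exact. Lie algebroid connections $D$ on $E$ correspond bijectively to its holomorphic splittings, both when these are given as holomorphic homomorphisms $\varphi:E\to J^1_V(E)$ with $\beta'\circ\varphi=\mathrm{Id}$ and when they are given as holomorphic homomorphisms $\delta:J^1_V(E)\to E\otimes V^*$ with $\delta\circ\alpha'=\mathrm{Id}$. The bijections are determined by $$\varphi(s(x))=[(-D(s)(x),\ j^1_xs)],\qquad \delta([(v,\ j^1_xs)])=v+D(s)(x)$$ for every local holomorphic section $s$ of $E$, every point $x$ of its domain and every $v\in(E\otimes V^*)_x$. (2) Suppose that $E$ has positive rank. Let $\beta'':\mathrm{Hom}(E,J^1_V(E))\to\mathrm{End}(E)$ be the composition with $\beta'$, and $A_V(E)=(\beta'')^{-1}(\mathcal O_X\cdot\mathrm{Id}_E)$. Then the sequence $0\to\mathrm{End}(E)\otimes V^*\xrightarrow{\hat\alpha}A_V(E)\xrightarrow{\hat\beta}\mathcal O_X\to0$ is exact, where $\hat\alpha(T\otimes\theta)(e)=\alpha'(T(e)\otimes\theta)$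 and $\beta''(\psi)=\hat\beta(\psi)\cdot\mathrm{Id}_E$. Lie algebroid connections on $E$ correspond bijectively to its holomorphic splittings, that is, to the holomorphic homomorphisms $\psi:\mathcal O_X\to A_V(E)$ with $\hat\beta\circ\psi=\mathrm{Id}$; the splitting $\psi$ of $D$ is determined by $\psi(c)(e)=c\,\varphi(e)$, with $\varphi$ the splitting of $D$ in (1). -/

import Mathlib

open scoped Manifold ContDiff TensorProduct Topology
open TopologicalSpace (Opens)

set_option linter.unusedSectionVars false

noncomputable section

section Extension

variable {X : Type*} [TopologicalSpace X] {E : X → Type*} [∀ x, AddCommGroup (E x)]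

open Classical in
/-- Extension by zero of a section over `U`; only its germs at the points of `U` are ever used. -/
def extendZero {U : Opens X} (s : ∀ x : U, E x) : ∀ x, E x :=
  fun x => if h : x ∈ U then s ⟨x, h⟩ else 0

lemma extendZero_add {U : Opens X} (s t : ∀ x : U, E x) :
    extendZero (s + t) = fun x => extendZero s x + extendZero t x := by
  ext x; by_cases h : x ∈ U <;> simp [extendZero, h]

lemma extendZero_smul [∀ x, Module ℂ (E x)] {U : Opens X} (f : U → ℂ) (s : ∀ x : U, E x) :
    extendZero (fun x => f x • s x) =
      fun x => extendZero (E := fun _ : X => ℂ) f x • extendZero s x := by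
  ext x; by_cases h : x ∈ U <;> simp [extendZero, h]

end Extension

section HolomorphicStructures

variable {X : Type*} [TopologicalSpace X] [ChartedSpace ℂ X] [IsManifold 𝓘(ℂ) ω X]

/-- `f` is a holomorphic function in some neighbourhood of `x`. -/
abbrev HolFunAt (f : X → ℂ) (x : X) : Prop := ContMDiffAt 𝓘(ℂ) 𝓘(ℂ) ω f x

/-- A sheaf of `O_X`-modules whose sections over an open set are some of the (set-theoretic)
sections of the family `E` of complex vector spaces.  `HolAt x s` says that `s` is a holomorphic
section in some neighbourhood of `x`; only the germ of `s` at `x` matters, so that the sections over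
an open set `U` (see `HolStr.sections`) automatically form a sheaf. -/
structure HolStr (E : X → Type*) [∀ x, AddCommGroup (E x)] [∀ x, Module ℂ (E x)] where
  HolAt : X → (∀ y, E y) → Prop
  congr : ∀ {x : X} {s t : ∀ y, E y}, HolAt x s → (∀ᶠ y in 𝓝 x, s y = t y) → HolAt x t
  eventually : ∀ {x : X} {s : ∀ y, E y}, HolAt x s → ∀ᶠ y in 𝓝 x, HolAt y s
  zero : ∀ x : X, HolAt x (fun _ => 0)
  add : ∀ {x : X} {s t : ∀ y, E y}, HolAt x s → HolAt x t → HolAt x (fun y => s y + t y)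
  smul : ∀ {x : X} {f : X → ℂ} {s : ∀ y, E y}, HolFunAt f x → HolAt x s →
    HolAt x (fun y => f y • s y)

/-- The holomorphic sections of a holomorphic vector bundle. -/
def HolStr.ofBundle (F : Type*) [NormedAddCommGroup F] [NormedSpace ℂ F]
    (E : X → Type*) [TopologicalSpace (Bundle.TotalSpace F E)] [∀ x, AddCommGroup (E x)]
    [∀ x, Module ℂ (E x)] [∀ x, TopologicalSpace (E x)] [FiberBundle F E] [VectorBundle ℂ F E]
    [ContMDiffVectorBundle ω F E 𝓘(ℂ)] : HolStr E where
  HolAt x s := ContMDiffAt 𝓘(ℂ) (𝓘(ℂ).prod 𝓘(ℂ, F)) ω (fun y => Bundle.TotalSpace.mk' F y (s y)) x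
  congr h e := h.congr_of_eventuallyEq (e.mono fun y hy => by simp [hy])
  eventually h := (contMDiffAt_iff_contMDiffAt_nhds (by simp)).1 h
  zero x := (Bundle.contMDiff_zeroSection ℂ E).contMDiffAt
  add hs ht := hs.add_section ht
  smul hf hs := hf.smul_section hs

/-- The holomorphic tangent bundle `TX`. -/
def HolStr.tangent (X : Type*) [TopologicalSpace X] [ChartedSpace ℂ X] [IsManifold 𝓘(ℂ) ω X] :
    HolStr (fun x : X => TangentSpace 𝓘(ℂ) x) :=
  HolStr.ofBundle ℂ (TangentSpace 𝓘(ℂ))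

/-- The structure sheaf `O_X`, as the trivial line bundle. -/
def HolStr.trivial (X : Type*) [TopologicalSpace X] [ChartedSpace ℂ X] [IsManifold 𝓘(ℂ) ω X] :
    HolStr (fun _ : X => ℂ) where
  HolAt x s := HolFunAt s x
  congr h e := h.congr_of_eventuallyEq (e.mono fun y hy => hy.symm)
  eventually h := (contMDiffAt_iff_contMDiffAt_nhds (by simp)).1 h
  zero x := contMDiffAt_const
  add hs ht := hs.add ht
  smul hf hs := hf.smul hs

variable {E : X → Type*} [∀ x, AddCommGroup (E x)] [∀ x, Module ℂ (E x)]
variable {G : X → Type*} [∀ x, AddCommGroup (G x)] [∀ x, Module ℂ (G x)]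
variable {P : X → Type*} [∀ x, AddCommGroup (P x)] [∀ x, Module ℂ (P x)]

/-- `Hom(E, G)`: a family of linear maps is holomorphic near `x` if it maps holomorphic sections of
`E` over open subsets of some neighbourhood of `x` to holomorphic sections of `G`. -/
def HolStr.hom (hE : HolStr E) (hG : HolStr G) : HolStr (fun x => E x →ₗ[ℂ] G x) where
  HolAt x T := ∀ᶠ y in 𝓝 x, ∀ s, hE.HolAt y s → hG.HolAt y (fun z => T z (s z))
  congr h e := by
    filter_upwards [h, e.eventually_nhds] with y hy ey s hs
    exact hG.congr (hy s hs) (ey.mono fun z hz => by rw [hz])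
  eventually h := h.eventually_nhds
  zero x := Filter.Eventually.of_forall fun y s _ => by simpa using hG.zero y
  add h k := by
    filter_upwards [h, k] with y hy ky s hs
    exact hG.add (hy s hs) (ky s hs)
  smul hf h := by
    have hf' : ∀ᶠ y in 𝓝 _, HolFunAt _ y :=
      (contMDiffAt_iff_contMDiffAt_nhds (by simp)).1 hf
    filter_upwards [h, hf'] with y hy fy s hs
    exact hG.smul fy (hy s hs)

/-- The dual bundle. -/
def HolStr.dual (hE : HolStr E) : HolStr (fun x => Module.Dual ℂ (E x)) :=
  hE.hom (HolStr.trivial X)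

/-- The sections that are locally finite sums of members of a family `S` of local sections, `S x`
being the set of those members that are defined near `x`. -/
def HolStr.generate (S : X → Set (∀ y, E y))
    (hS : ∀ x, ∀ s ∈ S x, ∀ᶠ y in 𝓝 x, s ∈ S y)
    (hf : ∀ x, ∀ s ∈ S x, ∀ f, HolFunAt f x → (fun y => f y • s y) ∈ S x) : HolStr E where
  HolAt x s := ∃ t ∈ AddSubmonoid.closure (S x), ∀ᶠ y in 𝓝 x, s y = t y
  congr := by
    rintro x s s' ⟨t, ht, h⟩ e
    exact ⟨t, ht, by filter_upwards [h, e] with y hy ey; rw [← ey, hy]⟩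
  eventually := by
    rintro x s ⟨t, ht, h⟩
    have : ∀ᶠ y in 𝓝 x, t ∈ AddSubmonoid.closure (S y) := by
      clear h
      induction ht using AddSubmonoid.closure_induction with
      | mem t ht => exact (hS x t ht).mono fun y hy => AddSubmonoid.subset_closure hy
      | zero => exact Filter.Eventually.of_forall fun y => zero_mem _
      | add a b _ _ ha hb =>
        filter_upwards [ha, hb] with y hya hyb
        exact add_mem hya hyb
    filter_upwards [this, h.eventually_nhds] with y hy ey
    exact ⟨t, hy, ey⟩
  zero x := ⟨0, zero_mem _, Filter.Eventually.of_forall fun _ => rfl⟩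
  add := by
    rintro x s s' ⟨t, ht, h⟩ ⟨t', ht', h'⟩
    refine ⟨t + t', add_mem ht ht', ?_⟩
    filter_upwards [h, h'] with y hy hy'
    rw [hy, hy', Pi.add_apply]
  smul := by
    rintro x f s hfx ⟨t, ht, h⟩
    refine ⟨fun y => f y • t y, ?_, by filter_upwards [h] with y hy; rw [hy]⟩
    clear h
    induction ht using AddSubmonoid.closure_induction with
    | mem t ht => exact AddSubmonoid.subset_closure (hf x t ht f hfx)
    | zero =>
      have : (fun y => f y • (0 : ∀ y, E y) y) = 0 := by ext y; simp
      rw [this]; exact zero_mem _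
    | add a b _ _ ha hb =>
      have : (fun y => f y • (a + b) y) = (fun y => f y • a y) + fun y => f y • b y := by
        ext y; simp
      rw [this]; exact add_mem ha hb

/-- `E ⊗ G`: the holomorphic sections are locally the finite sums `∑ sᵢ ⊗ tᵢ` with `sᵢ`, `tᵢ`
holomorphic. -/
def HolStr.tensor (hE : HolStr E) (hG : HolStr G) : HolStr (fun x => E x ⊗[ℂ] G x) :=
  HolStr.generate
    (fun x => {u | ∃ s t, hE.HolAt x s ∧ hG.HolAt x t ∧ u = fun y => s y ⊗ₜ[ℂ] t y})
    (by
      rintro x _ ⟨s, t, hs, ht, rfl⟩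
      filter_upwards [hE.eventually hs, hG.eventually ht] with y hy hy'
      exact ⟨s, t, hy, hy', rfl⟩)
    (by
      rintro x _ ⟨s, t, hs, ht, rfl⟩ f hf
      exact ⟨fun y => f y • s y, t, hE.smul hf hs, ht, by ext y; rw [TensorProduct.smul_tmul']⟩)

/-- `E ⊕ G`. -/
def HolStr.prod (hE : HolStr E) (hG : HolStr G) : HolStr (fun x => E x × G x) where
  HolAt x s := hE.HolAt x (fun y => (s y).1) ∧ hG.HolAt x (fun y => (s y).2)
  congr h e := ⟨hE.congr h.1 (e.mono fun y hy => by rw [hy]),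
    hG.congr h.2 (e.mono fun y hy => by rw [hy])⟩
  eventually h := (hE.eventually h.1).and (hG.eventually h.2)
  zero x := ⟨hE.zero x, hG.zero x⟩
  add h k := ⟨hE.add h.1 k.1, hG.add h.2 k.2⟩
  smul hf h := ⟨hE.smul hf h.1, hG.smul hf h.2⟩

/-- The quotient `E / N`: a section is holomorphic if it lifts locally to a holomorphic section
of `E`. -/
def HolStr.quotient (hE : HolStr E) (N : ∀ x, Submodule ℂ (E x)) : HolStr (fun x => E x ⧸ N x) where
  HolAt x s := ∃ t, hE.HolAt x t ∧ ∀ᶠ y in 𝓝 x, s y = (N y).mkQ (t y)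
  congr := by
    rintro x s s' ⟨t, ht, h⟩ e
    exact ⟨t, ht, by filter_upwards [h, e] with y hy ey; rw [← ey, hy]⟩
  eventually := by
    rintro x s ⟨t, ht, h⟩
    filter_upwards [hE.eventually ht, h.eventually_nhds] with y hy ey
    exact ⟨t, hy, ey⟩
  zero x := ⟨_, hE.zero x, Filter.Eventually.of_forall fun y => by simp⟩
  add := by
    rintro x s s' ⟨t, ht, h⟩ ⟨t', ht', h'⟩
    refine ⟨_, hE.add ht ht', ?_⟩
    filter_upwards [h, h'] with y hy hy'
    rw [hy, hy', map_add]
  smul := by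
    rintro x f s hf ⟨t, ht, h⟩
    refine ⟨_, hE.smul hf ht, ?_⟩
    filter_upwards [h] with y hy
    rw [hy, map_smul]

/-- A family of subspaces of `E`, with the sections that are holomorphic as sections of `E`. -/
def HolStr.sub (hE : HolStr E) (N : ∀ x, Submodule ℂ (E x)) : HolStr (fun x => N x) where
  HolAt x s := hE.HolAt x (fun y => (s y : E y))
  congr h e := hE.congr h (e.mono fun y hy => by rw [hy])
  eventually h := hE.eventually h
  zero x := hE.zero x
  add h k := hE.add h k
  smul hf h := hE.smul hf h

/-- A family of linear maps is a holomorphic (that is, `O_X`-linear) homomorphism if it maps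
holomorphic local sections to holomorphic local sections. -/
def IsHolHom (hE : HolStr E) (hG : HolStr G) (T : ∀ x, E x →ₗ[ℂ] G x) : Prop :=
  ∀ x s, hE.HolAt x s → hG.HolAt x (fun y => T y (s y))

/-- `0 → E → G → P → 0` is a short exact sequence of holomorphic homomorphisms: exact on the fibres
and exact as a sequence of sheaves of sections. -/
structure IsHolShortExact (hE : HolStr E) (hG : HolStr G) (hP : HolStr P)
    (i : ∀ x, E x →ₗ[ℂ] G x) (p : ∀ x, G x →ₗ[ℂ] P x) : Prop where
  hol_left : IsHolHom hE hG i
  hol_right : IsHolHom hG hP p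
  injective : ∀ x, Function.Injective (i x)
  exact : ∀ x, Function.Exact (i x) (p x)
  surjective : ∀ x, Function.Surjective (p x)
  exact_sections : ∀ x s, hG.HolAt x s → (∀ᶠ y in 𝓝 x, p y (s y) = 0) →
    ∃ t, hE.HolAt x t ∧ ∀ᶠ y in 𝓝 x, i y (t y) = s y
  surjective_sections : ∀ x s, hP.HolAt x s →
    ∃ t, hG.HolAt x t ∧ ∀ᶠ y in 𝓝 x, p y (t y) = s y

/-- A holomorphic splitting of a short exact sequence, as a right inverse of its surjection `p`. -/
@[ext] structure HolSplitting (hG : HolStr G) (hP : HolStr P) (p : ∀ x, G x →ₗ[ℂ] P x) where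
  toFun : ∀ x, P x →ₗ[ℂ] G x
  hol : IsHolHom hP hG toFun
  right_inv : ∀ x, p x ∘ₗ toFun x = LinearMap.id

/-- A holomorphic splitting of a short exact sequence, as a left inverse of its injection `i`. -/
@[ext] structure HolRetraction (hE : HolStr E) (hG : HolStr G) (i : ∀ x, E x →ₗ[ℂ] G x) where
  toFun : ∀ x, G x →ₗ[ℂ] E x
  hol : IsHolHom hG hE toFun
  left_inv : ∀ x, toFun x ∘ₗ i x = LinearMap.id

/-- The space `Γ(U, E)` of holomorphic sections over an open set. -/
def HolStr.sections (hE : HolStr E) (U : Opens X) : Submodule ℂ (∀ x : U, E x) where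
  carrier := {s | ∀ x : U, hE.HolAt x (extendZero s)}
  add_mem' hs ht x := by rw [extendZero_add]; exact hE.add (hs x) (ht x)
  zero_mem' x := by
    have : extendZero (0 : ∀ x : U, E x) = fun _ => 0 := by ext y; simp [extendZero]
    rw [this]; exact hE.zero _
  smul_mem' c s hs x := by
    have : extendZero (c • s) = fun x => c • extendZero s x := by
      ext y; by_cases h : y ∈ U <;> simp [extendZero, h]
    rw [this]; exact hE.smul contMDiffAt_const (hs x)

/-- Restriction of holomorphic sections. -/
def HolStr.res (hE : HolStr E) {U W : Opens X} (h : W ≤ U) (s : hE.sections U) : hE.sections W :=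
  ⟨fun x => s.1 ⟨x, h x.2⟩, fun x => by
    refine hE.congr (s.2 ⟨x, h x.2⟩) ?_
    filter_upwards [W.isOpen.mem_nhds x.2] with y hy
    have hy' : y ∈ W := hy
    simp [extendZero, hy', h hy']⟩

/-- The product of a holomorphic function and a holomorphic section. -/
def HolStr.funSmul (hE : HolStr E) {U : Opens X} (f : (HolStr.trivial X).sections U)
    (s : hE.sections U) : hE.sections U :=
  ⟨fun x => f.1 x • s.1 x, fun x => by
    rw [extendZero_smul]; exact hE.smul (f.2 x) (s.2 x)⟩

/-- The differential at `x` of a function that is holomorphic near `x`, as an element of the fibre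
`(K_X)_x`. -/
def cotangentDiff (f : X → ℂ) (x : X) : Module.Dual ℂ (TangentSpace 𝓘(ℂ) x) :=
  ContinuousLinearMap.toLinearMap (mfderiv 𝓘(ℂ) 𝓘(ℂ) f x)

/-- The differential of a holomorphic function on `U` at a point of `U`. -/
def sectionDiff {U : Opens X} (f : (HolStr.trivial X).sections U) (x : U) :
    Module.Dual ℂ (TangentSpace 𝓘(ℂ) (x : X)) :=
  cotangentDiff (extendZero (E := fun _ : X => ℂ) f.1) x

end HolomorphicStructures

section LieAlgebroids

variable {X : Type*} [TopologicalSpace X] [ChartedSpace ℂ X] [IsManifold 𝓘(ℂ) ω X]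
variable {V : X → Type*} [∀ x, AddCommGroup (V x)] [∀ x, Module ℂ (V x)]

/-- The structure of a holomorphic Lie algebroid on `V`. -/
structure LieAlgebroid (hV : HolStr V) where
  bracket : ∀ U : Opens X, hV.sections U →ₗ[ℂ] hV.sections U →ₗ[ℂ] hV.sections U
  bracket_res : ∀ {U W : Opens X} (h : W ≤ U) (s t : hV.sections U),
    bracket W (hV.res h s) (hV.res h t) = hV.res h (bracket U s t)
  antisymm : ∀ (U : Opens X) (s t : hV.sections U), bracket U s t = - bracket U t s
  jacobi : ∀ (U : Opens X) (s t u : hV.sections U),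
    bracket U (bracket U s t) u + bracket U (bracket U t u) s + bracket U (bracket U u s) t = 0
  /-- the anchor map -/
  anchor : ∀ x, V x →ₗ[ℂ] TangentSpace 𝓘(ℂ) x
  anchor_hol : IsHolHom hV (HolStr.tangent X) anchor
  anchor_bracket : ∀ (U : Opens X) (s t : hV.sections U) (x : U),
    anchor x ((bracket U s t).1 x) =
      VectorField.mlieBracket 𝓘(ℂ) (fun y => anchor y (extendZero s.1 y))
        (fun y => anchor y (extendZero t.1 y)) x
  leibniz : ∀ (U : Opens X) (f : (HolStr.trivial X).sections U) (s t : hV.sections U) (x : U),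
    (bracket U (hV.funSmul f s) t).1 x =
      f.1 x • (bracket U s t).1 x - sectionDiff f x (anchor x (t.1 x)) • s.1 x

variable {hV : HolStr V}

/-- The dual `φ^* : K_X → V^*` of the anchor map, on the fibres. -/
def LieAlgebroid.coanchor (L : LieAlgebroid hV) (x : X) :
    Module.Dual ℂ (TangentSpace 𝓘(ℂ) x) →ₗ[ℂ] Module.Dual ℂ (V x) :=
  (L.anchor x).dualMap

variable {E : X → Type*} [∀ x, AddCommGroup (E x)] [∀ x, Module ℂ (E x)]

/-- A Lie algebroid connection on `E`: a `ℂ`-linear homomorphism of sheaves `D : E → E ⊗ V^*` with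
`D(fs) = f D(s) + s ⊗ φ^*(df)`.  By this identity the commutator of `D` with a function is
`O_X`-linear, so that `D` is a first order holomorphic differential operator. -/
@[ext] structure LieAlgebroidConnection (L : LieAlgebroid hV) (hE : HolStr E) where
  toFun : ∀ U : Opens X, hE.sections U →ₗ[ℂ] (hE.tensor hV.dual).sections U
  map_res : ∀ {U W : Opens X} (h : W ≤ U) (s : hE.sections U),
    toFun W (hE.res h s) = (hE.tensor hV.dual).res h (toFun U s)
  leibniz : ∀ (U : Opens X) (f : (HolStr.trivial X).sections U) (s : hE.sections U) (x : U),
    (toFun U (hE.funSmul f s)).1 x =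
      f.1 x • (toFun U s).1 x + s.1 x ⊗ₜ[ℂ] L.coanchor x (sectionDiff f x)

end LieAlgebroids

section Jets

variable {X : Type*} [TopologicalSpace X] [ChartedSpace ℂ X] [IsManifold 𝓘(ℂ) ω X]
variable {E : X → Type*} [∀ x, AddCommGroup (E x)] [∀ x, Module ℂ (E x)]

/-- The sections of `E` that are holomorphic near `x`. -/
def HolStr.germs (hE : HolStr E) (x : X) : Submodule ℂ (∀ y, E y) where
  carrier := {s | hE.HolAt x s}
  add_mem' hs ht := hE.add hs ht
  zero_mem' := hE.zero x
  smul_mem' _ _ hs := hE.smul contMDiffAt_const hs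

/-- The sections of `E` near `x` whose germ lies in `m_x² E`, where `m_x` is the ideal of the germs
of holomorphic functions that vanish at `x`. -/
def HolStr.germsSq (hE : HolStr E) (x : X) : Submodule ℂ (hE.germs x) :=
  Submodule.span ℂ {s | ∃ (f g : X → ℂ) (t : ∀ y, E y), HolFunAt f x ∧ HolFunAt g x ∧
    hE.HolAt x t ∧ f x = 0 ∧ g x = 0 ∧ ∀ᶠ y in 𝓝 x, s.1 y = f y • g y • t y}

/-- The fibre `J¹(E)_x`: the holomorphic sections of `E` over the first order infinitesimal
neighbourhood of `x`. -/
def JetFiber (hE : HolStr E) (x : X) := hE.germs x ⧸ hE.germsSq x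

instance (hE : HolStr E) (x : X) : AddCommGroup (JetFiber hE x) :=
  inferInstanceAs (AddCommGroup (hE.germs x ⧸ hE.germsSq x))

instance (hE : HolStr E) (x : X) : Module ℂ (JetFiber hE x) :=
  inferInstanceAs (Module ℂ (hE.germs x ⧸ hE.germsSq x))

/-- The class in `J¹(E)_x` of a section that is holomorphic near `x`. -/
def jetMk (hE : HolStr E) (x : X) : hE.germs x →ₗ[ℂ] JetFiber hE x := (hE.germsSq x).mkQ

open Classical in
/-- The jet at `x` of a section that is holomorphic near `x`. -/
def jet (hE : HolStr E) (s : ∀ y, E y) (x : X) : JetFiber hE x :=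
  if h : hE.HolAt x s then jetMk hE x ⟨s, h⟩ else 0

/-- The jet bundle `J¹(E)`: the holomorphic sections are locally the finite sums `∑ fᵢ · j¹(sᵢ)`
with `fᵢ`, `sᵢ` holomorphic. -/
def HolStr.jets (hE : HolStr E) : HolStr (JetFiber hE) :=
  HolStr.generate
    (fun x => {u | ∃ (f : X → ℂ) (s : ∀ y, E y), HolFunAt f x ∧ hE.HolAt x s ∧
      u = fun y => f y • jet hE s y})
    (by
      rintro x _ ⟨f, s, hf, hs, rfl⟩
      have hf' : ∀ᶠ y in 𝓝 x, HolFunAt f y := (HolStr.trivial X).eventually hf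
      filter_upwards [hf', hE.eventually hs] with y hy hy'
      exact ⟨f, s, hy, hy', rfl⟩)
    (by
      rintro x _ ⟨f, s, hf, hs, rfl⟩ g hg
      exact ⟨fun y => g y * f y, s, hg.mul hf, hs, by ext y; rw [mul_smul]⟩)

/-- The evaluation `β : J¹(E) → E`, on the fibres. -/
def jetEval (hE : HolStr E) (x : X) : JetFiber hE x →ₗ[ℂ] E x :=
  (hE.germsSq x).liftQ (LinearMap.proj x ∘ₗ (hE.germs x).subtype) (by
    rw [HolStr.germsSq, Submodule.span_le]
    rintro s ⟨f, g, t, -, -, -, hf, -, h⟩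
    simp [h.self_of_nhds, hf])

lemma jet_eq (hE : HolStr E) {s : ∀ y, E y} {x : X} (h : hE.HolAt x s) :
    jet hE s x = jetMk hE x ⟨s, h⟩ := by simp [jet, h]

lemma jetEval_jet (hE : HolStr E) {s : ∀ y, E y} {x : X} (h : hE.HolAt x s) :
    jetEval hE x (jet hE s x) = s x := by
  rw [jet_eq hE h]; rfl

lemma jet_add (hE : HolStr E) {s t : ∀ y, E y} {x : X} (hs : hE.HolAt x s) (ht : hE.HolAt x t) :
    jet hE (fun y => s y + t y) x = jet hE s x + jet hE t x := by
  rw [jet_eq hE hs, jet_eq hE ht, jet_eq hE (hE.add hs ht), ← map_add]; rfl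

lemma jet_smul (hE : HolStr E) (c : ℂ) {s : ∀ y, E y} {x : X} (hs : hE.HolAt x s) :
    jet hE (fun y => c • s y) x = c • jet hE s x := by
  rw [jet_eq hE hs, jet_eq hE (hE.smul contMDiffAt_const hs), ← map_smul]; rfl

end Jets

section LieAlgebroidJets

variable {X : Type*} [TopologicalSpace X] [ChartedSpace ℂ X] [IsManifold 𝓘(ℂ) ω X]
variable (F : Type*) [NormedAddCommGroup F] [NormedSpace ℂ F]
variable (E : X → Type*) [TopologicalSpace (Bundle.TotalSpace F E)] [∀ x, AddCommGroup (E x)]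
variable [∀ x, Module ℂ (E x)] [∀ x, TopologicalSpace (E x)] [FiberBundle F E] [VectorBundle ℂ F E]
variable [ContMDiffVectorBundle ω F E 𝓘(ℂ)]

/-- The local section of `E` through `e ∈ E_x` that is constant in the preferred trivialization. -/
def constExt (x : X) (e : E x) : ∀ y, E y := fun y =>
  (trivializationAt F E x).symmL ℂ y ((trivializationAt F E x).continuousLinearMapAt ℂ x e)

/-- The local function that is linear in the preferred chart, vanishes at `x` and has
differential `w` at `x`. -/
def linExt (x : X) (w : Module.Dual ℂ (TangentSpace 𝓘(ℂ) x)) : X → ℂ := fun y =>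
  w (extChartAt 𝓘(ℂ) x y - extChartAt 𝓘(ℂ) x x : ℂ)

variable {E} in
lemma constExt_self (x : X) (e : E x) : constExt F E x e x = e := by
  simp only [constExt]
  exact (trivializationAt F E x).symmL_continuousLinearMapAt
    (FiberBundle.mem_baseSet_trivializationAt' x) e

variable {E} in
lemma holAt_constExt (x : X) (e : E x) : (HolStr.ofBundle F E).HolAt x (constExt F E x e) := by
  refine (Bundle.contMDiffAt_section x).2 ?_
  refine (contMDiffAt_const
    (c := (trivializationAt F E x).continuousLinearMapAt ℂ x e)).congr_of_eventuallyEq ?_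
  filter_upwards [(trivializationAt F E x).open_baseSet.mem_nhds
    (FiberBundle.mem_baseSet_trivializationAt' x)] with y hy
  simp only [constExt]
  have := (trivializationAt F E x).continuousLinearMapAt_symmL (R := ℂ) hy
    ((trivializationAt F E x).continuousLinearMapAt ℂ x e)
  rwa [Bundle.Trivialization.continuousLinearMapAt_apply,
    Bundle.Trivialization.linearMapAt_apply, if_pos hy] at this

lemma linExt_self (x : X) (w : Module.Dual ℂ (TangentSpace 𝓘(ℂ) x)) : linExt x w x = 0 := by
  simp only [linExt, sub_self]; exact map_zero (show ℂ →ₗ[ℂ] ℂ from w)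

lemma holAt_linExt (x : X) (w : Module.Dual ℂ (TangentSpace 𝓘(ℂ) x)) :
    HolFunAt (linExt x w) x := by
  have h1 : ContMDiffAt 𝓘(ℂ) 𝓘(ℂ) ω (fun y => extChartAt 𝓘(ℂ) x y - extChartAt 𝓘(ℂ) x x) x :=
    contMDiffAt_extChartAt.sub contMDiffAt_const
  exact ((show ℂ →ₗ[ℂ] ℂ from w).toContinuousLinearMap.contMDiff.contMDiffAt).comp x h1

/-- The homomorphism `α : E ⊗ K_X → J¹(E)` on the fibres: `e ⊗ w` goes to the jet at `x` of `f s`,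
where `f(x) = 0`, `df_x = w` and `s(x) = e`.  The choice of `f` and `s` is immaterial, see
`jetSymbol_apply`. -/
def jetSymbol (x : X) :
    E x ⊗[ℂ] Module.Dual ℂ (TangentSpace 𝓘(ℂ) x) →ₗ[ℂ] JetFiber (HolStr.ofBundle F E) x :=
  TensorProduct.lift <| LinearMap.mk₂ ℂ
    (fun e w => jet (HolStr.ofBundle F E) (fun y => linExt x w y • constExt F E x e y) x)
    (fun e e' w => by
      rw [← jet_add _ ((HolStr.ofBundle F E).smul (holAt_linExt x w) (holAt_constExt F x e))
        ((HolStr.ofBundle F E).smul (holAt_linExt x w) (holAt_constExt F x e'))]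
      congr 1; ext y; simp only [constExt, map_add, smul_add])
    (fun c e w => by
      rw [← jet_smul _ _ ((HolStr.ofBundle F E).smul (holAt_linExt x w) (holAt_constExt F x e))]
      congr 1; ext y; simp only [constExt, map_smul, smul_comm c])
    (fun e w w' => by
      rw [← jet_add _ ((HolStr.ofBundle F E).smul (holAt_linExt x w) (holAt_constExt F x e))
        ((HolStr.ofBundle F E).smul (holAt_linExt x w') (holAt_constExt F x e))]
      congr 1; ext y; rw [← add_smul]; rfl)
    (fun c e w => by
      rw [← jet_smul _ _ ((HolStr.ofBundle F E).smul (holAt_linExt x w) (holAt_constExt F x e))]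
      congr 1; ext y; rw [smul_smul]; rfl)

lemma jetEval_jetSymbol (x : X) (u : E x ⊗[ℂ] Module.Dual ℂ (TangentSpace 𝓘(ℂ) x)) :
    jetEval (HolStr.ofBundle F E) x (jetSymbol F E x u) = 0 := by
  induction u with
  | zero => simp
  | add a b ha hb => rw [map_add, map_add, ha, hb, add_zero]
  | tmul e w =>
    simp only [jetSymbol, TensorProduct.lift.tmul, LinearMap.mk₂_apply]
    rw [jetEval_jet _ ((HolStr.ofBundle F E).smul (holAt_linExt x w) (holAt_constExt F x e)),
      linExt_self, zero_smul]

section Intrinsic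

lemma exists_eq_smul_of_eq_zero {H : Type*} [NormedAddCommGroup H] [NormedSpace ℂ H]
    [CompleteSpace H] {x : X} {h : X → H} (hh : ContMDiffAt 𝓘(ℂ) 𝓘(ℂ, H) ω h x) (h0 : h x = 0) :
    ∃ g : X → H, ContMDiffAt 𝓘(ℂ) 𝓘(ℂ, H) ω g x ∧
      (∀ᶠ y in 𝓝 x, h y = (extChartAt 𝓘(ℂ) x y - extChartAt 𝓘(ℂ) x x) • g y) ∧
      g x = mfderiv 𝓘(ℂ) 𝓘(ℂ, H) h x (1 : ℂ) := by
  set z := extChartAt 𝓘(ℂ) x with hz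
  set k : ℂ → H := h ∘ z.symm with hk
  have hz' : z.symm (z x) = x := extChartAt_to_inv x
  have hka : AnalyticAt ℂ k (z x) := by
    have := (contMDiffAt_iff.1 hh).2
    simp only [extChartAt_model_space_eq_id, PartialEquiv.refl_coe, Function.id_comp,
      modelWithCornersSelf_coe, Set.range_id, contDiffWithinAt_univ] at this
    exact this.analyticAt
  have hd : AnalyticAt ℂ (dslope k (z x)) (z x) := by
    obtain ⟨p, hp⟩ := hka
    exact ⟨_, hp.has_fpower_series_dslope_fslope⟩
  have hz2 : ContMDiffAt 𝓘(ℂ) 𝓘(ℂ) ω z x := contMDiffAt_extChartAt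
  refine ⟨fun y => dslope k (z x) (z y), ?_, ?_, ?_⟩
  · exact (hd.contDiffAt.contMDiffAt).comp x hz2
  · filter_upwards [extChartAt_source_mem_nhds (I := 𝓘(ℂ)) x] with y hy
    rw [sub_smul_dslope]
    simp only [hk, Function.comp_apply]
    rw [hz', h0, sub_zero, z.left_inv hy]
  · have hm : MDifferentiableAt 𝓘(ℂ) 𝓘(ℂ, H) h x := hh.mdifferentiableAt (by simp)
    have h1 := dslope_same k (z x)
    refine h1.trans ?_
    have h2 : fderivWithin ℂ (writtenInExtChartAt 𝓘(ℂ) 𝓘(ℂ, H) x h) (Set.range 𝓘(ℂ))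
        (extChartAt 𝓘(ℂ) x x) = fderiv ℂ k (z x) := by
      simp only [writtenInExtChartAt, extChartAt_model_space_eq_id, PartialEquiv.refl_coe,
        Function.id_comp, modelWithCornersSelf_coe, Set.range_id, fderivWithin_univ]
      rfl
    have h3 := congrArg (fun L : ℂ →L[ℂ] H => L 1) (hm.mfderiv.trans h2)
    exact h3.symm

variable [FiniteDimensional ℂ F]

/-- The value of `jetSymbol` in terms of arbitrary representatives. -/
theorem jetSymbol_apply {x : X} {f : X → ℂ} {s : ∀ y, E y} (hf : HolFunAt f x) (hf0 : f x = 0)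
    (hs : (HolStr.ofBundle F E).HolAt x s) :
    jetSymbol F E x (s x ⊗ₜ cotangentDiff f x) =
      jet (HolStr.ofBundle F E) (fun y => f y • s y) x := by
  set hE := HolStr.ofBundle F E
  set w := cotangentDiff f x with hw
  set l := linExt x w with hl
  set c := constExt F E x (s x) with hc
  set z : X → ℂ := fun y => extChartAt 𝓘(ℂ) x y - extChartAt 𝓘(ℂ) x x with hz
  have hlh : HolFunAt l x := holAt_linExt x w
  have hch : hE.HolAt x c := holAt_constExt F x (s x)
  have hzh : HolFunAt z x := contMDiffAt_extChartAt.sub contMDiffAt_const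
  have hz0 : z x = 0 := by simp [hz]
  -- the difference of the functions
  obtain ⟨g, hg, hge, hgx⟩ := exists_eq_smul_of_eq_zero hf hf0
  have hlz : ∀ y, l y = z y * g x := by
    intro y
    have : l y = w (z y • (1 : ℂ) : ℂ) := by simp [hl, linExt, hz]
    rw [this, hgx]
    exact map_smul w (z y) (1 : ℂ)
  -- the difference of the sections
  have hdh : hE.HolAt x (fun y => s y + (-1 : ℂ) • c y) :=
    hE.add hs (hE.smul contMDiffAt_const hch)
  have hd0 : s x + (-1 : ℂ) • c x = 0 := by simp [hc, constExt_self]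
  set T := trivializationAt F E x with hT
  have hxT : x ∈ T.baseSet := FiberBundle.mem_baseSet_trivializationAt' x
  obtain ⟨k, hk, hke, -⟩ := exists_eq_smul_of_eq_zero ((Bundle.contMDiffAt_section x).1 hdh)
    (by rw [hd0]; exact congrArg Prod.snd (T.zeroSection ℂ hxT))
  have hth : hE.HolAt x (fun y => T.symmL ℂ y (k y)) := by
    refine (Bundle.contMDiffAt_section x).2 (hk.congr_of_eventuallyEq ?_)
    filter_upwards [T.open_baseSet.mem_nhds hxT] with y hy
    have := T.continuousLinearMapAt_symmL (R := ℂ) hy (k y)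
    rwa [Bundle.Trivialization.continuousLinearMapAt_apply,
      Bundle.Trivialization.linearMapAt_apply, if_pos hy] at this
  have hte : ∀ᶠ y in 𝓝 x, s y + (-1 : ℂ) • c y = z y • T.symmL ℂ y (k y) := by
    filter_upwards [T.open_baseSet.mem_nhds hxT, hke] with y hy hky
    have h1 : T.continuousLinearMapAt ℂ y (s y + (-1 : ℂ) • c y) = z y • k y := by
      rw [Bundle.Trivialization.continuousLinearMapAt_apply,
        Bundle.Trivialization.linearMapAt_apply, if_pos hy]
      exact hky
    have h2 := T.symmL_continuousLinearMapAt (R := ℂ) hy (s y + (-1 : ℂ) • c y)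
    rw [h1, map_smul] at h2
    exact h2.symm
  simp only [jetSymbol, TensorProduct.lift.tmul, LinearMap.mk₂_apply]
  change jet hE (fun y => l y • c y) x = _
  rw [jet_eq hE (hE.smul hlh hch), jet_eq hE (hE.smul hf hs), eq_comm]
  refine (Submodule.Quotient.eq _).2 ?_
  have hgs : HolFunAt (fun y => g y - g x) x := hg.sub contMDiffAt_const
  have m1 : (⟨_, hE.smul hzh (hE.smul hgs hs)⟩ : hE.germs x) ∈ hE.germsSq x :=
    Submodule.subset_span ⟨z, fun y => g y - g x, s, hzh, hgs, hs, hz0, sub_self _,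
      Filter.Eventually.of_forall fun _ => rfl⟩
  have m2 : (⟨fun y => f y • s y, hE.smul hf hs⟩ - ⟨fun y => l y • c y, hE.smul hlh hch⟩
      - ⟨_, hE.smul hzh (hE.smul hgs hs)⟩ : hE.germs x) ∈ hE.germsSq x := by
    refine Submodule.subset_span ⟨l, z, _, hlh, hzh, hth, linExt_self x w, hz0, ?_⟩
    filter_upwards [hge, hte] with y hy hy'
    change f y • s y - l y • c y - z y • (g y - g x) • s y = _
    rw [← hy', hlz, hy, smul_add, smul_smul, smul_smul, smul_eq_mul]
    change (z y * g y) • s y - _ - _ = _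
    module
  simpa using add_mem m2 m1

end Intrinsic

variable {V : X → Type*} [∀ x, AddCommGroup (V x)] [∀ x, Module ℂ (V x)] {hV : HolStr V}
variable (L : LieAlgebroid hV)

/-- `Δ : E ⊗ K_X → (E ⊗ V^*) ⊕ J¹(E)`, `e ⊗ w ↦ (-e ⊗ φ^*(w), α(e ⊗ w))`, on the fibres. -/
def jetDelta (x : X) : E x ⊗[ℂ] Module.Dual ℂ (TangentSpace 𝓘(ℂ) x) →ₗ[ℂ]
    (E x ⊗[ℂ] Module.Dual ℂ (V x)) × JetFiber (HolStr.ofBundle F E) x :=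
  (-(LinearMap.lTensor (E x) (L.coanchor x))).prod (jetSymbol F E x)

/-- The fibres of `J¹_V(E) = ((E ⊗ V^*) ⊕ J¹(E)) / Δ(E ⊗ K_X)`. -/
def VJetFiber (x : X) :=
  ((E x ⊗[ℂ] Module.Dual ℂ (V x)) × JetFiber (HolStr.ofBundle F E) x) ⧸
    LinearMap.range (jetDelta F E L x)

instance (x : X) : AddCommGroup (VJetFiber F E L x) :=
  inferInstanceAs (AddCommGroup
    (((E x ⊗[ℂ] Module.Dual ℂ (V x)) × JetFiber (HolStr.ofBundle F E) x) ⧸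
      LinearMap.range (jetDelta F E L x)))

instance (x : X) : Module ℂ (VJetFiber F E L x) :=
  inferInstanceAs (Module ℂ
    (((E x ⊗[ℂ] Module.Dual ℂ (V x)) × JetFiber (HolStr.ofBundle F E) x) ⧸
      LinearMap.range (jetDelta F E L x)))

/-- The Lie algebroid jet bundle `J¹_V(E)`. -/
def vJets : HolStr (VJetFiber F E L) :=
  (((HolStr.ofBundle F E).tensor hV.dual).prod (HolStr.ofBundle F E).jets).quotient
    (fun x => LinearMap.range (jetDelta F E L x))

/-- The class of a pair `(v, j)` in `J¹_V(E)`. -/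
def vJetMk (x : X) : ((E x ⊗[ℂ] Module.Dual ℂ (V x)) × JetFiber (HolStr.ofBundle F E) x) →ₗ[ℂ]
    VJetFiber F E L x :=
  (LinearMap.range (jetDelta F E L x)).mkQ

/-- The inclusion `α' : E ⊗ V^* → J¹_V(E)`. -/
def vJetIncl (x : X) : E x ⊗[ℂ] Module.Dual ℂ (V x) →ₗ[ℂ] VJetFiber F E L x :=
  vJetMk F E L x ∘ₗ LinearMap.inl ℂ _ _

/-- The projection `β' : J¹_V(E) → E`. -/
def vJetProj (x : X) : VJetFiber F E L x →ₗ[ℂ] E x :=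
  (LinearMap.range (jetDelta F E L x)).liftQ
    (jetEval (HolStr.ofBundle F E) x ∘ₗ LinearMap.snd ℂ _ _) (by
      rintro _ ⟨u, rfl⟩
      exact jetEval_jetSymbol F E x u)

/-- `β'' : Hom(E, J¹_V(E)) → End(E)`, the composition with `β'`. -/
def homProj (x : X) : (E x →ₗ[ℂ] VJetFiber F E L x) →ₗ[ℂ] (E x →ₗ[ℂ] E x) :=
  LinearMap.compRight ℂ (vJetProj F E L x)

/-- `α'' : End(E) ⊗ V^* → Hom(E, J¹_V(E))`, which sends `T ⊗ θ` to `e ↦ α'(T e ⊗ θ)`. -/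
def homIncl (x : X) : (E x →ₗ[ℂ] E x) ⊗[ℂ] Module.Dual ℂ (V x) →ₗ[ℂ]
    (E x →ₗ[ℂ] VJetFiber F E L x) :=
  TensorProduct.lift <| LinearMap.mk₂ ℂ
    (fun T θ => vJetIncl F E L x ∘ₗ (TensorProduct.mk ℂ (E x) (Module.Dual ℂ (V x))).flip θ ∘ₗ T)
    (fun T T' θ => by ext e; simp)
    (fun c T θ => by ext e; simp)
    (fun T θ θ' => by ext e; simp)
    (fun c T θ => by ext e; simp)

/-- The fibres of `A_V(E) = (β'')⁻¹(O_X · Id_E)`. -/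
def atiyahFiber (x : X) : Submodule ℂ (E x →ₗ[ℂ] VJetFiber F E L x) :=
  (Submodule.span ℂ {(LinearMap.id : E x →ₗ[ℂ] E x)}).comap (homProj F E L x)

/-- The subbundle `A_V(E)` of `Hom(E, J¹_V(E))`. -/
def atiyahBundle : HolStr (fun x => atiyahFiber F E L x) :=
  ((HolStr.ofBundle F E).hom (vJets F E L)).sub (atiyahFiber F E L)

lemma homProj_homIncl (x : X) (u : (E x →ₗ[ℂ] E x) ⊗[ℂ] Module.Dual ℂ (V x)) :
    homProj F E L x (homIncl F E L x u) = 0 := by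
  induction u with
  | zero => simp
  | add a b ha hb => rw [map_add, map_add, ha, hb, add_zero]
  | tmul T θ =>
    ext e
    change jetEval (HolStr.ofBundle F E) x 0 = 0
    exact map_zero _

/-- The inclusion of `End(E) ⊗ V^*` in `A_V(E)`. -/
def atiyahIncl (x : X) : (E x →ₗ[ℂ] E x) ⊗[ℂ] Module.Dual ℂ (V x) →ₗ[ℂ] atiyahFiber F E L x :=
  (homIncl F E L x).codRestrict _ fun u => by
    rw [atiyahFiber, Submodule.mem_comap, homProj_homIncl]; exact zero_mem _

/-- The projection `A_V(E) → O_X`: the scalar `c` such that `β''` takes the value `c · Id_E`. -/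
def atiyahProj (hE : ∀ x, Nontrivial (E x)) (x : X) : atiyahFiber F E L x →ₗ[ℂ] ℂ :=
  haveI := hE x
  (LinearEquiv.coord ℂ (E x →ₗ[ℂ] E x) LinearMap.id
      (one_ne_zero : (1 : Module.End ℂ (E x)) ≠ 0)).toLinearMap ∘ₗ
    ((homProj F E L x).restrict fun _ h => h)

end LieAlgebroidJets

end

/-! The sequence for $J^1_V(E)$ is the pushout of the jet sequence $0\to E\otimes K_X\to J^1(E)\to
E\to0$ along $\mathrm{id}\otimes\phi^*$. On fibres its exactness follows from `jetSymbol_injective`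
and `exists_jetSymbol_eq`, which say that $\alpha$ is injective with image $\ker\beta$. On sections
the key is the Leibniz rule $j^1(fs)=f\,j^1s+\alpha(s\otimes df)$ (`jet_funSmul`): modulo $\Delta$
the last term lies in $E\otimes V^*$, so every holomorphic section of $J^1_V(E)$ is locally
$[(v,j^1s)]$ with $v$ and $s$ holomorphic (`vJets_holAt_iff`). Holomorphy and exactness can then be
read off from $v$ and $s$.

A connection $D$ kills $m_x^2E$ at $x$, by its Leibniz rule, and so factors through a linear map on
$J^1(E)_x$ (`evalJet`). The composite of this map with $\alpha$ is $\mathrm{id}\otimes\phi^*$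
(`evalJet_jetSymbol`), hence $(v,j^1s)\mapsto v+D(s)$ vanishes on the image of $\Delta$ and descends
to a left inverse $\delta$ of $\alpha'$. Conversely, $D(s)=\delta([(0,j^1s)])$ is a connection by
the Leibniz rule for jets. Left and right inverses correspond through
$\varphi\circ\beta'=\mathrm{Id}-\alpha'\circ\delta$, which accounts for the sign of $D$ in
$\varphi$.

A splitting of $A_V(E)\to\mathcal O_X$ is determined by its value at $1$, which is a right inverse
of $\beta'$. Exactness of the second sequence is obtained from that of the first with a local frame
of $E$ and its dual frame. -/

noncomputable section

/-! ### Sections, jets and differentials as germs; the two kinds of splittings -/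

section HolomorphicSections

variable {X : Type*} [TopologicalSpace X] [ChartedSpace ℂ X] [IsManifold 𝓘(ℂ) ω X]
variable {E : X → Type*} [∀ x, AddCommGroup (E x)] [∀ x, Module ℂ (E x)]
variable {G : X → Type*} [∀ x, AddCommGroup (G x)] [∀ x, Module ℂ (G x)]
variable {P : X → Type*} [∀ x, AddCommGroup (P x)] [∀ x, Module ℂ (P x)]

lemma extendZero_apply_mem {Y : Type*} [TopologicalSpace Y] {A : Y → Type*}
    [∀ x, AddCommGroup (A x)] {U : Opens Y} (s : ∀ x : U, A x) {y : Y} (hy : y ∈ U) :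
    extendZero s y = s ⟨y, hy⟩ := by
  simp [extendZero, hy]

/-- The set of points near which a function is holomorphic is open. -/
lemma HolFunAt.eventually_holFunAt {f : X → ℂ} {x : X} (hf : HolFunAt f x) :
    ∀ᶠ y in 𝓝 x, HolFunAt f y :=
  (HolStr.trivial X).eventually hf

lemma HolStr.neg (hE : HolStr E) {x : X} {s : ∀ y, E y} (hs : hE.HolAt x s) :
    hE.HolAt x (fun y => - s y) := by
  have := hE.smul (contMDiffAt_const (c := (-1 : ℂ))) hs
  simpa using this

lemma HolStr.sub' (hE : HolStr E) {x : X} {s t : ∀ y, E y} (hs : hE.HolAt x s)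
    (ht : hE.HolAt x t) : hE.HolAt x (fun y => s y - t y) := by
  simpa only [sub_eq_add_neg] using hE.add hs (hE.neg ht)

lemma HolStr.sum (hE : HolStr E) {x : X} {ι : Type*} (I : Finset ι) {s : ι → ∀ y, E y}
    (hs : ∀ i ∈ I, hE.HolAt x (s i)) : hE.HolAt x (fun y => ∑ i ∈ I, s i y) := by
  classical
  induction I using Finset.induction_on with
  | empty => simpa using hE.zero x
  | insert a I ha ih =>
    simp only [Finset.sum_insert ha]
    exact hE.add (hs a (by simp)) (ih fun i hi => hs i (by simp [hi]))

/-- Holomorphy of linear maps out of a generated sheaf may be tested on generators. -/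
lemma HolStr.generate_map {hG : HolStr G} {S : X → Set (∀ y, E y)}
    {hS : ∀ x, ∀ s ∈ S x, ∀ᶠ y in 𝓝 x, s ∈ S y}
    {hf : ∀ x, ∀ s ∈ S x, ∀ f, HolFunAt f x → (fun y => f y • s y) ∈ S x}
    {T : ∀ y, E y →ₗ[ℂ] G y} {x : X} (h : ∀ s ∈ S x, hG.HolAt x (fun y => T y (s y)))
    {s : ∀ y, E y} (hs : (HolStr.generate S hS hf).HolAt x s) :
    hG.HolAt x (fun y => T y (s y)) := by
  obtain ⟨t, ht, e⟩ := hs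
  refine hG.congr (s := fun y => T y (t y)) ?_ (e.mono fun y hy => by rw [hy])
  clear e
  induction ht using AddSubmonoid.closure_induction with
  | mem t ht => exact h t ht
  | zero => simpa using hG.zero x
  | add a b _ _ ha hb => simpa using hG.add ha hb

lemma HolStr.tensor_tmul (hE : HolStr E) (hG : HolStr G) {x : X} {s : ∀ y, E y} {t : ∀ y, G y}
    (hs : hE.HolAt x s) (ht : hG.HolAt x t) :
    (hE.tensor hG).HolAt x (fun y => s y ⊗ₜ[ℂ] t y) :=
  ⟨_, AddSubmonoid.subset_closure ⟨s, t, hs, ht, rfl⟩, Filter.Eventually.of_forall fun _ => rfl⟩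

lemma HolStr.jets_smul_jet (hE : HolStr E) {x : X} {f : X → ℂ} {s : ∀ y, E y}
    (hf : HolFunAt f x) (hs : hE.HolAt x s) :
    hE.jets.HolAt x (fun y => f y • jet hE s y) :=
  ⟨_, AddSubmonoid.subset_closure ⟨f, s, hf, hs, rfl⟩, Filter.Eventually.of_forall fun _ => rfl⟩

lemma HolStr.jets_jet (hE : HolStr E) {x : X} {s : ∀ y, E y} (hs : hE.HolAt x s) :
    hE.jets.HolAt x (fun y => jet hE s y) := by
  simpa using hE.jets_smul_jet (contMDiffAt_const (c := (1 : ℂ))) hs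

/-- The jet at a point depends only on the germ. -/
lemma jet_congr (hE : HolStr E) {x : X} {s t : ∀ y, E y} (e : ∀ᶠ y in 𝓝 x, s y = t y) :
    jet hE s x = jet hE t x := by
  by_cases hs : hE.HolAt x s
  · have ht := hE.congr hs e
    rw [jet_eq hE hs, jet_eq hE ht]
    -- The difference vanishes near `x`, so it is the product `0 • 0 • 0` in $m_x^2E$.
    refine (Submodule.Quotient.eq _).2 (Submodule.subset_span
      ⟨fun _ => 0, fun _ => 0, fun _ => 0, contMDiffAt_const, contMDiffAt_const, hE.zero x,
        rfl, rfl, ?_⟩)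
    filter_upwards [e] with y hy
    change s y - t y = _
    simp [hy]
  · have ht : ¬ hE.HolAt x t := fun ht => hs (hE.congr ht (e.mono fun _ h => h.symm))
    simp [jet, hs, ht]

lemma jet_zero (hE : HolStr E) (x : X) : jet hE (fun _ => 0) x = 0 := by
  rw [jet_eq hE (hE.zero x)]
  exact map_zero _

lemma exists_jet_eq (hE : HolStr E) {x : X} (j : JetFiber hE x) :
    ∃ s, hE.HolAt x s ∧ jet hE s x = j := by
  obtain ⟨⟨s, hs⟩, rfl⟩ := Submodule.Quotient.mk_surjective _ j
  exact ⟨s, hs, jet_eq hE hs⟩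

/-- The differential of a function depends only on the germ. -/
lemma cotangentDiff_congr {f g : X → ℂ} {x : X} (e : f =ᶠ[𝓝 x] g) :
    cotangentDiff f x = cotangentDiff g x := by
  simp only [cotangentDiff, e.mfderiv_eq]

/-- The product rule: both terms carry a factor that vanishes at `x`. This is why differentials do
not see $m_x^2$. -/
lemma cotangentDiff_mul {f g : X → ℂ} {x : X} (hf : HolFunAt f x) (hg : HolFunAt g x)
    (hf0 : f x = 0) (hg0 : g x = 0) : cotangentDiff (fun y => f y * g y) x = 0 := by
  have h := ((hf.mdifferentiableAt (by simp)).hasMFDerivAt.mul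
    (hg.mdifferentiableAt (by simp)).hasMFDerivAt).mfderiv
  have : mfderiv 𝓘(ℂ) 𝓘(ℂ) (fun y => f y * g y) x = 0 := by
    refine h.trans ?_
    rw [hf0, hg0]
    have z : ∀ A B : ℂ →L[ℂ] ℂ, (0 : ℂ) • A + (0 : ℂ) • B = 0 := by
      intro A B; ext; simp
    exact z _ _
  simp only [cotangentDiff, this]
  rfl

lemma cotangentDiff_sub_const {f : X → ℂ} {x : X} (hf : HolFunAt f x) (c : ℂ) :
    cotangentDiff (fun y => f y - c) x = cotangentDiff f x := by
  have h := ((hf.mdifferentiableAt (by simp)).hasMFDerivAt.sub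
    (hasMFDerivAt_const c x)).mfderiv
  have : mfderiv 𝓘(ℂ) 𝓘(ℂ) (fun y => f y - c) x = mfderiv 𝓘(ℂ) 𝓘(ℂ) f x := by
    refine h.trans ?_
    exact sub_zero _
  simp only [cotangentDiff, this]

/-- The derivative of a holomorphic function along a holomorphic vector field is holomorphic. -/
lemma holFunAt_cotangentDiff_apply {f : X → ℂ} {x : X} (hf : HolFunAt f x)
    {W : ∀ y : X, TangentSpace 𝓘(ℂ) y} (hW : (HolStr.tangent X).HolAt x W) :
    HolFunAt (fun y => cotangentDiff f y (W y)) x := by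
  have A := ContMDiffAt.mfderiv_const (m := ω) hf (by simp)
  have h := ContMDiffAt.clm_apply_of_inCoordinates (b₁ := id) (b₂ := f) (v := W) A hW hf
  exact (contMDiff_snd_tangentBundle_modelSpace ℂ 𝓘(ℂ)).contMDiffAt.comp x h

/-- Paired with a holomorphic section $s$ of $V$, the form $\phi^*(df)$ gives the derivative of $f$
along the holomorphic vector field $\phi(s)$. -/
lemma LieAlgebroid.holAt_coanchor {hV : HolStr E} (L : LieAlgebroid hV) {f : X → ℂ} {x : X}
    (hf : HolFunAt f x) : hV.dual.HolAt x (fun y => L.coanchor y (cotangentDiff f y)) := by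
  filter_upwards [hf.eventually_holFunAt] with y hy s hs
  exact holFunAt_cotangentDiff_apply hy (L.anchor_hol y s hs)

/-- Splittings of a short exact sequence as left inverses of the injection are the same as right
inverses of the surjection. -/
def HolRetraction.equivSplitting {hE : HolStr E} {hG : HolStr G} {hP : HolStr P}
    {i : ∀ x, E x →ₗ[ℂ] G x} {p : ∀ x, G x →ₗ[ℂ] P x} (h : IsHolShortExact hE hG hP i p) :
    HolRetraction hE hG i ≃ HolSplitting hG hP p :=
  have hpi : ∀ x e, p x (i x e) = 0 := fun x e => (h.exact x _).2 ⟨e, rfl⟩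
  have hi : ∀ (δ : HolRetraction hE hG i) x e, δ.toFun x (i x e) = e := fun δ x e =>
    LinearMap.congr_fun (δ.left_inv x) e
  have hp : ∀ (φ : HolSplitting hG hP p) x e, p x (φ.toFun x e) = e := fun φ x e =>
    LinearMap.congr_fun (φ.right_inv x) e
  -- The map $\mathrm{Id}-i\circ\delta$ vanishes on $\ker p=\operatorname{im}i$, hence factors
  -- through `p`.
  have key₁ : ∀ δ : HolRetraction hE hG i, ∃ φ : HolSplitting hG hP p, ∀ x g,
      φ.toFun x (p x g) = g - i x (δ.toFun x g) := by
    intro δ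
    have hker : ∀ x, LinearMap.ker (p x) ≤
        LinearMap.ker (LinearMap.id - i x ∘ₗ δ.toFun x) := by
      intro x g hg
      obtain ⟨e, rfl⟩ := (h.exact x g).1 hg
      simp [hi]
    let q := fun x => (p x).quotKerEquivOfSurjective (h.surjective x)
    let T := fun x => (LinearMap.ker (p x)).liftQ _ (hker x) ∘ₗ (q x).symm.toLinearMap
    have hT : ∀ x g, T x (p x g) = g - i x (δ.toFun x g) := by
      intro x g
      have : (q x).symm (p x g) = (LinearMap.ker (p x)).mkQ g := by
        rw [LinearEquiv.symm_apply_eq]; rfl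
      change (LinearMap.ker (p x)).liftQ _ (hker x) ((q x).symm (p x g)) = _
      rw [this]; rfl
    refine ⟨⟨T, fun x s hs => ?_, fun x => ?_⟩, hT⟩
    -- Holomorphy is tested on a local holomorphic lift of `s` along `p`; this is where surjectivity
    -- on sections enters.
    · obtain ⟨t, ht, e⟩ := h.surjective_sections x s hs
      refine hG.congr (hG.sub' ht (h.hol_left x _ (δ.hol x t ht))) ?_
      filter_upwards [e] with y hy
      rw [← hy, hT]
    · ext e
      obtain ⟨g, rfl⟩ := h.surjective x e
      simp [hT, hpi]
  -- The map $\mathrm{Id}-\varphi\circ p$ has values in $\ker p=\operatorname{im}i$, where the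
  -- injective `i` can be inverted.
  have key₂ : ∀ φ : HolSplitting hG hP p, ∃ δ : HolRetraction hE hG i, ∀ x g,
      i x (δ.toFun x g) = g - φ.toFun x (p x g) := by
    intro φ
    have hr : ∀ x g, (LinearMap.id - φ.toFun x ∘ₗ p x : G x →ₗ[ℂ] G x) g ∈
        LinearMap.range (i x) := by
      intro x g
      refine (h.exact x _).1 ?_
      simp [hp]
    let q := fun x => LinearEquiv.ofInjective (i x) (h.injective x)
    let T := fun x => (q x).symm.toLinearMap ∘ₗ LinearMap.codRestrict _ _ (hr x)
    have hT : ∀ x g, i x (T x g) = g - φ.toFun x (p x g) := fun x g =>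
      congrArg Subtype.val ((q x).apply_symm_apply (LinearMap.codRestrict _ _ (hr x) g))
    refine ⟨⟨T, fun x s hs => ?_, fun x => ?_⟩, hT⟩
    · have hs' := hG.sub' hs (φ.hol x _ (h.hol_right x s hs))
      obtain ⟨t, ht, e⟩ := h.exact_sections x _ hs' (Filter.Eventually.of_forall fun y => by
        simp [hp])
      -- Exactness on sections provides a holomorphic preimage `t`; injectivity on the fibres
      -- identifies it with the image of `s` under `T`.
      refine hE.congr ht ?_
      filter_upwards [e] with y hy
      exact h.injective y (hy.trans (hT y _).symm)
    · ext e
      refine h.injective x ?_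
      simp [hT, hpi]
  { toFun := fun δ => (key₁ δ).choose
    invFun := fun φ => (key₂ φ).choose
    left_inv := fun δ => by
      ext x g
      refine h.injective x ?_
      rw [(key₂ _).choose_spec, (key₁ δ).choose_spec, sub_sub_cancel]
    right_inv := fun φ => by
      ext x e
      obtain ⟨g, rfl⟩ := h.surjective x e
      rw [(key₁ _).choose_spec, (key₂ φ).choose_spec, sub_sub_cancel] }

lemma HolRetraction.equivSplitting_apply {hE : HolStr E} {hG : HolStr G} {hP : HolStr P}
    {i : ∀ x, E x →ₗ[ℂ] G x} {p : ∀ x, G x →ₗ[ℂ] P x} (h : IsHolShortExact hE hG hP i p)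
    (δ : HolRetraction hE hG i) (x : X) (g : G x) :
    (HolRetraction.equivSplitting h δ).toFun x (p x g) = g - i x (δ.toFun x g) := by
  unfold HolRetraction.equivSplitting
  dsimp only [Equiv.coe_fn_mk]
  exact Exists.choose_spec (p := fun φ : HolSplitting hG hP p => ∀ x g,
      φ.toFun x (p x g) = g - i x (δ.toFun x g)) _ x g

end HolomorphicSections

/-! ### The first jet sequence of a holomorphic vector bundle -/

section HolomorphicBundles

variable {X : Type*} [TopologicalSpace X] [ChartedSpace ℂ X] [IsManifold 𝓘(ℂ) ω X]

lemma cotangentDiff_add {f g : X → ℂ} {x : X} (hf : HolFunAt f x) (hg : HolFunAt g x) :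
    cotangentDiff (fun y => f y + g y) x = cotangentDiff f x + cotangentDiff g x :=
  congrArg ContinuousLinearMap.toLinearMap
    ((hf.mdifferentiableAt (by simp)).hasMFDerivAt.add
      (hg.mdifferentiableAt (by simp)).hasMFDerivAt).mfderiv

lemma cotangentDiff_const_mul {f : X → ℂ} {x : X} (hf : HolFunAt f x) (c : ℂ) :
    cotangentDiff (fun y => c * f y) x = c • cotangentDiff f x :=
  congrArg ContinuousLinearMap.toLinearMap
    ((hf.mdifferentiableAt (by simp)).hasMFDerivAt.const_smul c).mfderiv

lemma cotangentDiff_const (c : ℂ) (x : X) : cotangentDiff (fun _ : X => c) x = 0 :=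
  congrArg ContinuousLinearMap.toLinearMap (hasMFDerivAt_const c x).mfderiv

/-- The fibre of the tangent bundle at `x` is identified with `ℂ` by the preferred chart at `x`, so
this chart has the identity as its derivative there. -/
lemma cotangentDiff_linExt (x : X) (w : Module.Dual ℂ (TangentSpace 𝓘(ℂ) x)) :
    cotangentDiff (linExt x w) x = w := by
  have : IsManifold 𝓘(ℂ) 1 X := IsManifold.of_le (n := ω) (by simp)
  have h1 : HasMFDerivAt 𝓘(ℂ) 𝓘(ℂ) (extChartAt 𝓘(ℂ) x) x (tangentCoordChange 𝓘(ℂ) x x x) := by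
    refine (mdifferentiableAt_extChartAt (mem_chart_source ℂ x)).hasMFDerivAt.congr_mfderiv ?_
    rw [← mfderiv_chartAt_eq_tangentCoordChange (I := 𝓘(ℂ)) (mem_chart_source ℂ x)]
    rfl
  let l : ℂ →L[ℂ] ℂ := (show ℂ →ₗ[ℂ] ℂ from w).toContinuousLinearMap
  have h3 := (l.hasMFDerivAt (x := extChartAt 𝓘(ℂ) x x)).comp x h1
  have hl : HolFunAt (l ∘ extChartAt 𝓘(ℂ) x) x :=
    l.contMDiff.contMDiffAt.comp x contMDiffAt_extChartAt
  have h4 := cotangentDiff_sub_const hl (l (extChartAt 𝓘(ℂ) x x))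
  rw [show (fun y => (l ∘ extChartAt 𝓘(ℂ) x) y - l (extChartAt 𝓘(ℂ) x x)) = linExt x w from
    funext fun y => (map_sub l _ _).symm] at h4
  rw [h4]
  refine (congrArg ContinuousLinearMap.toLinearMap h3.mfderiv).trans ?_
  refine LinearMap.ext fun (v : ℂ) => ?_
  have h5 : tangentCoordChange 𝓘(ℂ) x x x v = v :=
    tangentCoordChange_self (mem_extChartAt_source x)
  exact congrArg w h5

/-- A holomorphic coordinate of a section in `m_x² E` has vanishing differential at `x`. -/
lemma HolStr.cotangentDiff_eq_zero_of_mem_germsSq {E : X → Type*} [∀ x, AddCommGroup (E x)]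
    [∀ x, Module ℂ (E x)] (hE : HolStr E) {x : X} {l : ∀ y, Module.Dual ℂ (E y)}
    (hl : hE.dual.HolAt x l) {s : hE.germs x} (hs : s ∈ hE.germsSq x) :
    cotangentDiff (fun y => l y (s.1 y)) x = 0 := by
  have hol : ∀ s : hE.germs x, HolFunAt (fun y => l y (s.1 y)) x := fun s =>
    hl.self_of_nhds s.1 s.2
  induction hs using Submodule.span_induction with
  | mem s h =>
    obtain ⟨f, g, t, hf, hg, ht, hf0, hg0, e⟩ := h
    have ht' : HolFunAt (fun y => l y (t y)) x := hol ⟨t, ht⟩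
    -- The coordinate of $f\,g\,t$ is grouped as $f\cdot(g\cdot l(t))$, two factors that vanish at
    -- `x`.
    rw [← cotangentDiff_mul hf (hg.mul ht') hf0 (by simp [hg0])]
    refine cotangentDiff_congr ?_
    filter_upwards [e] with y hy
    simp [hy]
  | zero =>
    rw [← cotangentDiff_const 0 x]
    congr 1
    ext y
    exact map_zero _
  | add a b _ _ ha hb =>
    have := cotangentDiff_add (hol a) (hol b)
    rw [ha, hb, add_zero] at this
    rw [← this]
    congr 1
    ext y
    exact map_add _ _ _
  | smul c a _ ha =>
    have := cotangentDiff_const_mul (hol a) c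
    rw [ha, smul_zero] at this
    rw [← this]
    congr 1
    ext y
    exact map_smul _ _ _

variable (F : Type*) [NormedAddCommGroup F] [NormedSpace ℂ F]
variable (E : X → Type*) [TopologicalSpace (Bundle.TotalSpace F E)] [∀ x, AddCommGroup (E x)]
variable [∀ x, Module ℂ (E x)] [∀ x, TopologicalSpace (E x)] [FiberBundle F E] [VectorBundle ℂ F E]
variable [ContMDiffVectorBundle ω F E 𝓘(ℂ)]

/-- The linear form on the fibres of a vector bundle that is given by a linear form in the preferred
trivialization at `x`. -/
def trivCoord (x : X) (l : F →L[ℂ] ℂ) (y : X) : Module.Dual ℂ (E y) :=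
  (l.comp ((trivializationAt F E x).continuousLinearMapAt ℂ y)).toLinearMap

variable {E}

lemma trivCoord_apply {x y : X} (hy : y ∈ (trivializationAt F E x).baseSet) (l : F →L[ℂ] ℂ)
    (e : E y) : trivCoord F E x l y e = l (trivializationAt F E x ⟨y, e⟩).2 := by
  simp only [trivCoord, ContinuousLinearMap.coe_coe, ContinuousLinearMap.comp_apply]
  rw [Bundle.Trivialization.continuousLinearMapAt_apply,
    Bundle.Trivialization.linearMapAt_apply, if_pos hy]

lemma eventually_mem_baseSet (x : X) : ∀ᶠ y in 𝓝 x, y ∈ (trivializationAt F E x).baseSet :=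
  (trivializationAt F E x).open_baseSet.mem_nhds (FiberBundle.mem_baseSet_trivializationAt' x)

lemma holAt_trivCoord (x : X) (l : F →L[ℂ] ℂ) :
    (HolStr.ofBundle F E).dual.HolAt x (trivCoord F E x l) := by
  filter_upwards [eventually_mem_baseSet (E := E) F x] with y hy s hs
  have h := ((trivializationAt F E x).contMDiffAt_section_iff hy).1 hs
  refine (l.contMDiff.contMDiffAt.comp y h).congr_of_eventuallyEq ?_
  filter_upwards [(trivializationAt F E x).open_baseSet.mem_nhds hy] with z hz
  exact trivCoord_apply F hz l (s z)

lemma constExt_apply_trivCoord {x y : X} (hy : y ∈ (trivializationAt F E x).baseSet)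
    (l : F →L[ℂ] ℂ) (e : E x) :
    trivCoord F E x l y (constExt F E x e y) = trivCoord F E x l x e := by
  simp only [trivCoord, constExt, ContinuousLinearMap.coe_coe, ContinuousLinearMap.comp_apply]
  rw [(trivializationAt F E x).continuousLinearMapAt_symmL (R := ℂ) hy]

/-- A holomorphic section that vanishes at `x` is divisible by the preferred coordinate. -/
lemma exists_eq_smul_section_of_eq_zero [CompleteSpace F] {x : X} {s : ∀ y, E y}
    (hs : (HolStr.ofBundle F E).HolAt x s) (h0 : s x = 0) :
    ∃ t, (HolStr.ofBundle F E).HolAt x t ∧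
      ∀ᶠ y in 𝓝 x, s y = (extChartAt 𝓘(ℂ) x y - extChartAt 𝓘(ℂ) x x) • t y := by
  set T := trivializationAt F E x with hT
  have hxT : x ∈ T.baseSet := FiberBundle.mem_baseSet_trivializationAt' x
  obtain ⟨k, hk, hke, -⟩ := exists_eq_smul_of_eq_zero ((Bundle.contMDiffAt_section x).1 hs)
    (by rw [h0]; exact congrArg Prod.snd (T.zeroSection ℂ hxT))
  refine ⟨fun y => T.symmL ℂ y (k y), ?_, ?_⟩
  · refine (Bundle.contMDiffAt_section x).2 (hk.congr_of_eventuallyEq ?_)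
    filter_upwards [T.open_baseSet.mem_nhds hxT] with y hy
    have := T.continuousLinearMapAt_symmL (R := ℂ) hy (k y)
    rwa [Bundle.Trivialization.continuousLinearMapAt_apply,
      Bundle.Trivialization.linearMapAt_apply, if_pos hy] at this
  · filter_upwards [T.open_baseSet.mem_nhds hxT, hke] with y hy hky
    have h1 : T.continuousLinearMapAt ℂ y (s y) =
        (extChartAt 𝓘(ℂ) x y - extChartAt 𝓘(ℂ) x x) • k y := by
      rw [Bundle.Trivialization.continuousLinearMapAt_apply,
        Bundle.Trivialization.linearMapAt_apply, if_pos hy]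
      exact hky
    have h2 := T.symmL_continuousLinearMapAt (R := ℂ) hy (s y)
    rw [h1, map_smul] at h2
    exact h2.symm

lemma holFunAt_extChartAt_sub (x : X) :
    HolFunAt (fun y => extChartAt 𝓘(ℂ) x y - extChartAt 𝓘(ℂ) x x) x :=
  contMDiffAt_extChartAt.sub contMDiffAt_const

variable (E)

/-- The linear form on `T_x X` that takes the value `1` at the preferred coordinate vector. -/
def unitCovector (x : X) : Module.Dual ℂ (TangentSpace 𝓘(ℂ) x) :=
  (LinearMap.id : ℂ →ₗ[ℂ] ℂ)

/-- The fibre of $K_X$ is a line, so every tensor is a pure one with a fixed covector. -/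
lemma exists_eq_tmul_unitCovector (x : X)
    (u : E x ⊗[ℂ] Module.Dual ℂ (TangentSpace 𝓘(ℂ) x)) : ∃ e, u = e ⊗ₜ unitCovector x := by
  induction u with
  | zero => exact ⟨0, by simp⟩
  | add a b ha hb =>
    obtain ⟨e, rfl⟩ := ha
    obtain ⟨e', rfl⟩ := hb
    exact ⟨e + e', by rw [TensorProduct.add_tmul]⟩
  | tmul e w =>
    have : w = (w (1 : ℂ)) • unitCovector x := by
      refine LinearMap.ext fun (v : ℂ) => ?_
      have h := map_smul w v (1 : ℂ)
      have hv : (v • (1 : ℂ) : ℂ) = v := by simp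
      exact ((congrArg w hv.symm).trans h).trans (mul_comm _ _)
    exact ⟨w (1 : ℂ) • e, by rw [TensorProduct.smul_tmul, ← this]⟩

lemma jetSymbol_tmul (x : X) (e : E x) (w : Module.Dual ℂ (TangentSpace 𝓘(ℂ) x)) :
    jetSymbol F E x (e ⊗ₜ w) =
      jet (HolStr.ofBundle F E) (fun y => linExt x w y • constExt F E x e y) x := rfl

/-- If the jet of $f\cdot s$ is zero, with $f$ the linear function and $s$ the constant extension of
$e$, then $fs\in m_x^2E$ and all coordinates $l(fs)=l(e)f$ have vanishing differential at `x`. As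
$df_x\ne0$, every coordinate of $e$ is zero. -/
lemma jetSymbol_injective [FiniteDimensional ℂ F] (x : X) :
    Function.Injective (jetSymbol F E x) := by
  rw [← LinearMap.ker_eq_bot, LinearMap.ker_eq_bot']
  intro u hu
  obtain ⟨e, rfl⟩ := exists_eq_tmul_unitCovector E x u
  have hol := (HolStr.ofBundle F E).smul (holAt_linExt x (unitCovector x)) (holAt_constExt F x e)
  rw [jetSymbol_tmul, jet_eq _ hol] at hu
  have hmem := (Submodule.Quotient.mk_eq_zero _).1 hu
  have hzero : ∀ l : F →L[ℂ] ℂ, trivCoord F E x l x e = 0 := by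
    intro l
    have h := (HolStr.ofBundle F E).cotangentDiff_eq_zero_of_mem_germsSq
      (holAt_trivCoord F x l) hmem
    have h' : cotangentDiff (fun y => trivCoord F E x l x e * linExt x (unitCovector x) y) x =
        0 := by
      rw [← h]
      refine cotangentDiff_congr ?_
      filter_upwards [eventually_mem_baseSet (E := E) F x] with y hy
      rw [map_smul, constExt_apply_trivCoord F hy, smul_eq_mul, mul_comm]
    rw [cotangentDiff_const_mul (holAt_linExt x _), cotangentDiff_linExt] at h'
    have h1 := LinearMap.congr_fun h' (1 : ℂ)
    exact (mul_one _).symm.trans h1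
  -- Continuous linear forms separate the points of `F`, by Hahn–Banach.
  have hT : (trivializationAt F E x).continuousLinearMapAt ℂ x e = 0 := by
    by_contra hne
    obtain ⟨l, -, hl⟩ := exists_dual_vector ℂ _ (norm_ne_zero_iff.2 hne)
    have := hzero l
    simp only [trivCoord, ContinuousLinearMap.coe_coe, ContinuousLinearMap.comp_apply] at this
    rw [this] at hl
    exact hne (norm_eq_zero.1 (by simpa using hl.symm))
  have he : e = 0 := by
    rw [← constExt_self F x e, constExt, hT, map_zero]
  rw [he, TensorProduct.zero_tmul]

/-- A section that vanishes at `x` is $z\cdot t$ for a local coordinate $z$ centred at `x`, so its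
jet is $\alpha(t(x)\otimes dz_x)$. -/
lemma exists_jetSymbol_eq [FiniteDimensional ℂ F] {x : X} {j : JetFiber (HolStr.ofBundle F E) x}
    (hj : jetEval _ x j = 0) : ∃ u, jetSymbol F E x u = j := by
  have : CompleteSpace F := FiniteDimensional.complete ℂ F
  obtain ⟨s, hs, rfl⟩ := exists_jet_eq _ j
  rw [jetEval_jet _ hs] at hj
  obtain ⟨t, ht, e⟩ := exists_eq_smul_section_of_eq_zero F hs hj
  refine ⟨t x ⊗ₜ cotangentDiff (fun y => extChartAt 𝓘(ℂ) x y - extChartAt 𝓘(ℂ) x x) x, ?_⟩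
  rw [jetSymbol_apply F E (holFunAt_extChartAt_sub x) (sub_self _) ht]
  exact jet_congr _ (e.mono fun y hy => hy.symm)

/-- The Leibniz rule for jets. -/
lemma jet_funSmul [FiniteDimensional ℂ F] {x : X} {f : X → ℂ} {s : ∀ y, E y} (hf : HolFunAt f x)
    (hs : (HolStr.ofBundle F E).HolAt x s) :
    jet (HolStr.ofBundle F E) (fun y => f y • s y) x =
      f x • jet (HolStr.ofBundle F E) s x + jetSymbol F E x (s x ⊗ₜ cotangentDiff f x) := by
  have hf' : HolFunAt (fun y => f y - f x) x := hf.sub contMDiffAt_const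
  rw [← cotangentDiff_sub_const hf (f x), jetSymbol_apply F E hf' (sub_self _) hs, ← jet_smul _ _ hs,
    ← jet_add _ ((HolStr.ofBundle F E).smul contMDiffAt_const hs)
      ((HolStr.ofBundle F E).smul hf' hs)]
  congr 1
  ext y
  rw [← add_smul, add_sub_cancel]

end HolomorphicBundles

/-! ### Exactness of the sequence of Lie algebroid jets -/

section LieAlgebroidJetSequence

variable {X : Type*} [TopologicalSpace X] [ChartedSpace ℂ X] [IsManifold 𝓘(ℂ) ω X]
variable (F : Type*) [NormedAddCommGroup F] [NormedSpace ℂ F] [FiniteDimensional ℂ F]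
variable (E : X → Type*) [TopologicalSpace (Bundle.TotalSpace F E)] [∀ x, AddCommGroup (E x)]
variable [∀ x, Module ℂ (E x)] [∀ x, TopologicalSpace (E x)] [FiberBundle F E] [VectorBundle ℂ F E]
variable [ContMDiffVectorBundle ω F E 𝓘(ℂ)]
variable {V : X → Type*} [∀ x, AddCommGroup (V x)] [∀ x, Module ℂ (V x)] {hV : HolStr V}
variable (L : LieAlgebroid hV)

lemma vJetMk_add (x : X) (v v' : E x ⊗[ℂ] Module.Dual ℂ (V x))
    (j j' : JetFiber (HolStr.ofBundle F E) x) :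
    vJetMk F E L x (v + v', j + j') = vJetMk F E L x (v, j) + vJetMk F E L x (v', j') := by
  rw [← map_add, Prod.mk_add_mk]

lemma vJetMk_eq (x : X) (v : E x ⊗[ℂ] Module.Dual ℂ (V x))
    (j : JetFiber (HolStr.ofBundle F E) x) :
    vJetMk F E L x (v, j) = vJetIncl F E L x v + vJetMk F E L x (0, j) := by
  rw [vJetIncl, LinearMap.comp_apply, LinearMap.inl_apply, ← vJetMk_add, add_zero, zero_add]

lemma vJetMk_surjective (x : X) : Function.Surjective (vJetMk F E L x) :=
  Submodule.mkQ_surjective _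

/-- The two sides differ by $\Delta(u)$; the minus sign in $\Delta$ makes the symbol of a jet equal
to $+(\mathrm{id}\otimes\phi^*)(u)$ in $E\otimes V^*$. -/
lemma vJetMk_jetSymbol (x : X) (u : E x ⊗[ℂ] Module.Dual ℂ (TangentSpace 𝓘(ℂ) x)) :
    vJetMk F E L x (0, jetSymbol F E x u) =
      vJetIncl F E L x (LinearMap.lTensor (E x) (L.coanchor x) u) := by
  refine (Submodule.Quotient.eq _).2 ⟨u, ?_⟩
  simp [jetDelta]

lemma vJetProj_vJetMk (x : X) (v : E x ⊗[ℂ] Module.Dual ℂ (V x))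
    (j : JetFiber (HolStr.ofBundle F E) x) :
    vJetProj F E L x (vJetMk F E L x (v, j)) = jetEval (HolStr.ofBundle F E) x j := rfl

lemma vJets_vJetMk {x : X} {v : ∀ y, E y ⊗[ℂ] Module.Dual ℂ (V y)}
    {j : ∀ y, JetFiber (HolStr.ofBundle F E) y}
    (hv : ((HolStr.ofBundle F E).tensor hV.dual).HolAt x v)
    (hj : (HolStr.ofBundle F E).jets.HolAt x j) :
    (vJets F E L).HolAt x (fun y => vJetMk F E L y (v y, j y)) :=
  ⟨fun y => (v y, j y), ⟨hv, hj⟩, Filter.Eventually.of_forall fun _ => rfl⟩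

/-- Modulo `E ⊗ V^*`, every holomorphic section of `J¹(E)` is locally a jet prolongation. -/
lemma exists_vJetMk_eq_of_jets {x : X} {j : ∀ y, JetFiber (HolStr.ofBundle F E) y}
    (hj : (HolStr.ofBundle F E).jets.HolAt x j) :
    ∃ v s, ((HolStr.ofBundle F E).tensor hV.dual).HolAt x v ∧ (HolStr.ofBundle F E).HolAt x s ∧
      ∀ᶠ y in 𝓝 x, vJetMk F E L y (0, j y) =
        vJetMk F E L y (v y, jet (HolStr.ofBundle F E) s y) := by
  set hE := HolStr.ofBundle F E with hhE
  obtain ⟨t, ht, e⟩ := hj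
  suffices h : ∃ v s, (hE.tensor hV.dual).HolAt x v ∧ hE.HolAt x s ∧
      ∀ᶠ y in 𝓝 x, vJetMk F E L y (0, t y) = vJetMk F E L y (v y, jet hE s y) by
    obtain ⟨v, s, hv, hs, h⟩ := h
    exact ⟨v, s, hv, hs, by filter_upwards [e, h] with y hy hy'; rw [hy, hy']⟩
  clear e
  induction ht using AddSubmonoid.closure_induction with
  | mem t ht =>
    obtain ⟨f, s, hf, hs, rfl⟩ := ht
    -- By the Leibniz rule $f\,j^1s=j^1(fs)-\alpha(s\otimes df)$, and $\alpha(s\otimes df)$ becomes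
    -- $s\otimes\phi^*(df)$ in the quotient.
    refine ⟨fun y => -(s y ⊗ₜ L.coanchor y (cotangentDiff f y)), fun y => f y • s y,
      (hE.tensor hV.dual).neg (hE.tensor_tmul _ hs (L.holAt_coanchor hf)), hE.smul hf hs, ?_⟩
    filter_upwards [hf.eventually_holFunAt, hE.eventually hs] with y hfy hsy
    rw [jet_funSmul F E hfy hsy, vJetMk_eq F E L y (-_), map_neg]
    have h := vJetMk_add F E L y 0 0 (f y • jet hE s y)
      (jetSymbol F E y (s y ⊗ₜ cotangentDiff f y))
    rw [add_zero, vJetMk_jetSymbol, LinearMap.lTensor_tmul] at h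
    rw [h]
    abel
  | zero =>
    exact ⟨_, _, (hE.tensor hV.dual).zero x, hE.zero x, Filter.Eventually.of_forall fun y => by
      rw [jet_zero]; rfl⟩
  | add a b _ _ ha hb =>
    obtain ⟨v, s, hv, hs, h⟩ := ha
    obtain ⟨v', s', hv', hs', h'⟩ := hb
    refine ⟨_, _, (hE.tensor hV.dual).add hv hv', hE.add hs hs', ?_⟩
    filter_upwards [h, h', hE.eventually hs, hE.eventually hs'] with y hy hy' hsy hsy'
    rw [jet_add _ hsy hsy', vJetMk_add, ← hy, ← hy', ← vJetMk_add, add_zero]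
    rfl

/-- The holomorphic sections of `J¹_V(E)` are locally the classes `[(v, j¹s)]`. -/
lemma vJets_holAt_iff {x : X} {σ : ∀ y, VJetFiber F E L y} :
    (vJets F E L).HolAt x σ ↔ ∃ v s, ((HolStr.ofBundle F E).tensor hV.dual).HolAt x v ∧
      (HolStr.ofBundle F E).HolAt x s ∧
      ∀ᶠ y in 𝓝 x, σ y = vJetMk F E L y (v y, jet (HolStr.ofBundle F E) s y) := by
  constructor
  · rintro ⟨t, ⟨ht₁, ht₂⟩, e⟩
    obtain ⟨v, s, hv, hs, h⟩ := exists_vJetMk_eq_of_jets F E L ht₂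
    refine ⟨_, s, ((HolStr.ofBundle F E).tensor hV.dual).add ht₁ hv, hs, ?_⟩
    filter_upwards [e, h] with y hy hy'
    rw [hy]
    change vJetMk F E L y ((t y).1, (t y).2) = _
    rw [vJetMk_eq, hy', vJetMk_eq, vJetMk_eq F E L y (_ + _), map_add]
    abel
  · rintro ⟨v, s, hv, hs, e⟩
    exact (vJets F E L).congr (vJets_vJetMk F E L hv ((HolStr.ofBundle F E).jets_jet hs))
      (e.mono fun y hy => hy.symm)

/-- If $(v,0)=\Delta(u)$, then $\alpha(u)=0$; injectivity of $\alpha$ gives $u=0$ and hence $v=0$.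
No injectivity of $\phi^*$ is needed. -/
lemma vJetIncl_injective (x : X) : Function.Injective (vJetIncl F E L x) := by
  rw [← LinearMap.ker_eq_bot, LinearMap.ker_eq_bot']
  intro v hv
  obtain ⟨u, hu⟩ := (Submodule.Quotient.mk_eq_zero _).1 hv
  have h1 : -(LinearMap.lTensor (E x) (L.coanchor x) u) = v := congrArg Prod.fst hu
  have h2 : jetSymbol F E x u = 0 := congrArg Prod.snd hu
  have h3 : u = 0 := jetSymbol_injective F E x (h2.trans (map_zero _).symm)
  rw [← h1, h3, map_zero, neg_zero]

lemma exact_vJetIncl_vJetProj (x : X) :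
    Function.Exact (vJetIncl F E L x) (vJetProj F E L x) := by
  intro σ
  constructor
  · intro h
    obtain ⟨⟨v, j⟩, rfl⟩ := vJetMk_surjective F E L x σ
    rw [vJetProj_vJetMk] at h
    obtain ⟨u, rfl⟩ := exists_jetSymbol_eq F E h
    exact ⟨v + LinearMap.lTensor (E x) (L.coanchor x) u, by
      rw [vJetMk_eq, vJetMk_jetSymbol, map_add]⟩
  · rintro ⟨v, rfl⟩
    exact map_zero (jetEval (HolStr.ofBundle F E) x)

/-- The sequence `0 → E ⊗ V^* → J¹_V(E) → E → 0` is exact. -/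
theorem isHolShortExact_vJets : IsHolShortExact ((HolStr.ofBundle F E).tensor hV.dual)
    (vJets F E L) (HolStr.ofBundle F E) (vJetIncl F E L) (vJetProj F E L) where
  hol_left x s hs := vJets_vJetMk F E L hs ((HolStr.ofBundle F E).jets.zero x)
  hol_right x σ hσ := by
    obtain ⟨v, s, -, hs, e⟩ := (vJets_holAt_iff F E L).1 hσ
    refine (HolStr.ofBundle F E).congr hs ?_
    filter_upwards [e, (HolStr.ofBundle F E).eventually hs] with y hy hsy
    rw [hy, vJetProj_vJetMk, jetEval_jet _ hsy]
  injective := vJetIncl_injective F E L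
  exact := exact_vJetIncl_vJetProj F E L
  surjective x e := ⟨vJetMk F E L x (0, jet (HolStr.ofBundle F E) (constExt F E x e) x), by
    rw [vJetProj_vJetMk, jetEval_jet _ (holAt_constExt F x e), constExt_self]⟩
  exact_sections x σ hσ h0 := by
    obtain ⟨v, s, hv, hs, e⟩ := (vJets_holAt_iff F E L).1 hσ
    refine ⟨v, hv, ?_⟩
    have hs0 : ∀ᶠ y in 𝓝 x, s y = 0 := by
      filter_upwards [e, h0, (HolStr.ofBundle F E).eventually hs] with y hy hy' hsy
      rw [← jetEval_jet _ hsy, ← hy', hy, vJetProj_vJetMk]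
    -- The jet of `s` at `y` is zero because `s` vanishes in a whole neighbourhood of `y`, not
    -- merely at `y`.
    filter_upwards [e, hs0.eventually_nhds] with y hy hy'
    rw [hy, jet_congr _ hy', jet_zero]
    rfl
  surjective_sections x s hs := by
    refine ⟨_, vJets_vJetMk F E L (((HolStr.ofBundle F E).tensor hV.dual).zero x)
      ((HolStr.ofBundle F E).jets_jet hs), ?_⟩
    filter_upwards [(HolStr.ofBundle F E).eventually hs] with y hy
    rw [vJetProj_vJetMk, jetEval_jet _ hy]

end LieAlgebroidJetSequence

/-! ### Connections as left inverses of $\alpha'$ -/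

section Connections

variable {X : Type*} [TopologicalSpace X] [ChartedSpace ℂ X] [IsManifold 𝓘(ℂ) ω X]

section Germs

variable {E : X → Type*} [∀ x, AddCommGroup (E x)] [∀ x, Module ℂ (E x)]

/-- The largest open set on which `s` is holomorphic. -/
def HolStr.domain (hE : HolStr E) (s : ∀ y, E y) : Opens X :=
  ⟨{y | hE.HolAt y s}, isOpen_iff_mem_nhds.2 fun _ h => hE.eventually h⟩

/-- The restriction to `U` of a section that is holomorphic near every point of `U`. -/
def HolStr.restrict (hE : HolStr E) {s : ∀ y, E y} (U : Opens X) (h : ∀ y ∈ U, hE.HolAt y s) :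
    hE.sections U :=
  ⟨fun y => s y, fun x => by
    refine hE.congr (h x x.2) ?_
    filter_upwards [U.isOpen.mem_nhds x.2] with y hy
    exact (extendZero_apply_mem (fun y : U => s y) hy).symm⟩

lemma HolStr.eventually_restrict_eq (hE : HolStr E) {s : ∀ y, E y} {U : Opens X}
    (h : ∀ y ∈ U, hE.HolAt y s) {x : X} (hx : x ∈ U) :
    ∀ᶠ y in 𝓝 x, extendZero (hE.restrict U h).1 y = s y := by
  filter_upwards [U.isOpen.mem_nhds hx] with y hy
  exact extendZero_apply_mem _ hy

/-- The section over the domain of a germ. -/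
def HolStr.germSection (hE : HolStr E) {x : X} (s : hE.germs x) : hE.sections (hE.domain s.1) :=
  hE.restrict _ fun _ h => h

lemma HolStr.mem_domain (hE : HolStr E) {x : X} (s : hE.germs x) : x ∈ hE.domain s.1 := s.2

lemma HolStr.eventually_germSection_eq (hE : HolStr E) {x : X} (s : hE.germs x) :
    ∀ᶠ y in 𝓝 x, extendZero (hE.germSection s).1 y = s.1 y :=
  hE.eventually_restrict_eq (fun _ h => h) (hE.mem_domain s)

lemma eventually_extendZero_eq {U : Opens X} (s : ∀ y : U, E y) {x : X} (hx : x ∈ U)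
    {t : ∀ y, E y} (h : ∀ y : U, s y = t y) : ∀ᶠ y in 𝓝 x, extendZero s y = t y := by
  filter_upwards [U.isOpen.mem_nhds hx] with y hy
  rw [extendZero_apply_mem s hy]
  exact h ⟨y, hy⟩

end Germs

variable {V : X → Type*} [∀ x, AddCommGroup (V x)] [∀ x, Module ℂ (V x)] {hV : HolStr V}
variable {L : LieAlgebroid hV}

namespace LieAlgebroidConnection

variable {E : X → Type*} [∀ x, AddCommGroup (E x)] [∀ x, Module ℂ (E x)] {hE : HolStr E}
variable (D : LieAlgebroidConnection L hE)

/-- The value of `D s` at a point depends only on the germ of `s`. -/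
lemma apply_eq_of_eventuallyEq {U W : Opens X} (s : hE.sections U) (t : hE.sections W) {x : X}
    (hU : x ∈ U) (hW : x ∈ W) (e : ∀ᶠ y in 𝓝 x, extendZero s.1 y = extendZero t.1 y) :
    (D.toFun U s).1 ⟨x, hU⟩ = (D.toFun W t).1 ⟨x, hW⟩ := by
  obtain ⟨N, hN, hNo, hxN⟩ := mem_nhds_iff.1 e
  -- Near `x` both sections restrict to the same section over `O`, and `D` commutes with
  -- restriction.
  let O : Opens X := ⟨N, hNo⟩ ⊓ (U ⊓ W)
  have hxO : x ∈ O := ⟨hxN, hU, hW⟩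
  have hOU : O ≤ U := inf_le_right.trans inf_le_left
  have hOW : O ≤ W := inf_le_right.trans inf_le_right
  have hres : hE.res hOU s = hE.res hOW t := by
    refine Subtype.ext (funext fun y => ?_)
    have h : extendZero s.1 (y : X) = extendZero t.1 (y : X) := hN y.2.1
    rwa [extendZero_apply_mem s.1 (hOU y.2), extendZero_apply_mem t.1 (hOW y.2)] at h
  have h1 := congrArg (fun u => u.1 ⟨x, hxO⟩) (D.map_res hOU s)
  have h2 := congrArg (fun u => u.1 ⟨x, hxO⟩) (D.map_res hOW t)
  rw [hres] at h1
  exact h1.symm.trans h2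

/-- The value of `D s` at `x`, for a section `s` that is holomorphic near `x`. -/
def evalGerm (x : X) : hE.germs x →ₗ[ℂ] E x ⊗[ℂ] Module.Dual ℂ (V x) where
  toFun s := (D.toFun _ (hE.germSection s)).1 ⟨x, s.2⟩
  map_add' s t := by
    -- The sum may be holomorphic on a larger set than its summands, so additivity is checked on
    -- their common domain.
    let U : Opens X := hE.domain s.1 ⊓ hE.domain t.1
    have hx : x ∈ U := ⟨s.2, t.2⟩
    let s' := hE.restrict (s := s.1) U fun _ h => h.1
    let t' := hE.restrict (s := t.1) U fun _ h => h.2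
    rw [D.apply_eq_of_eventuallyEq (hE.germSection s) s' s.2 hx ?_,
      D.apply_eq_of_eventuallyEq (hE.germSection t) t' t.2 hx ?_,
      D.apply_eq_of_eventuallyEq (hE.germSection (s + t)) (s' + t') (s + t).2 hx ?_, map_add]
    · rfl
    · filter_upwards [hE.eventually_germSection_eq (s + t),
        eventually_extendZero_eq (s' + t').1 (t := (s + t).1) hx fun _ => rfl] with y hy hy'
      rw [hy, hy']
    · filter_upwards [hE.eventually_germSection_eq t,
        hE.eventually_restrict_eq (s := t.1) (U := U) (fun _ h => h.2) hx] with y hy hy'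
      rw [hy, hy']
    · filter_upwards [hE.eventually_germSection_eq s,
        hE.eventually_restrict_eq (s := s.1) (U := U) (fun _ h => h.1) hx] with y hy hy'
      rw [hy, hy']
  map_smul' c s := by
    have hx := hE.mem_domain s
    rw [D.apply_eq_of_eventuallyEq (hE.germSection (c • s)) (c • hE.germSection s) (c • s).2 hx ?_,
      map_smul]
    · rfl
    · filter_upwards [hE.eventually_germSection_eq (c • s),
        eventually_extendZero_eq (c • hE.germSection s).1 (t := (c • s).1) hx fun _ => rfl]
        with y hy hy'
      rw [hy, hy']

lemma evalGerm_eq {U : Opens X} (s : hE.sections U) {x : X} (hx : x ∈ U) (t : hE.germs x)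
    (e : ∀ᶠ y in 𝓝 x, extendZero s.1 y = t.1 y) :
    D.evalGerm x t = (D.toFun U s).1 ⟨x, hx⟩ := by
  refine D.apply_eq_of_eventuallyEq _ s t.2 hx ?_
  filter_upwards [e, hE.eventually_germSection_eq t] with y hy hy'
  rw [hy, hy']

lemma evalGerm_congr {x : X} {s t : hE.germs x} (e : ∀ᶠ y in 𝓝 x, s.1 y = t.1 y) :
    D.evalGerm x s = D.evalGerm x t := by
  refine D.evalGerm_eq (hE.germSection t) t.2 s ?_
  filter_upwards [hE.eventually_germSection_eq t, e] with y hy hy'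
  rw [hy, hy']

lemma evalGerm_funSmul {x : X} {f : X → ℂ} {s : ∀ y, E y} (hf : HolFunAt f x)
    (hs : hE.HolAt x s) :
    D.evalGerm x ⟨fun y => f y • s y, hE.smul hf hs⟩ =
      f x • D.evalGerm x ⟨s, hs⟩ + s x ⊗ₜ[ℂ] L.coanchor x (cotangentDiff f x) := by
  let U : Opens X := (HolStr.trivial X).domain f ⊓ hE.domain s
  have hx : x ∈ U := ⟨hf, hs⟩
  let f' := (HolStr.trivial X).restrict (s := f) U fun _ h => h.1
  let s' := hE.restrict (s := s) U fun _ h => h.2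
  have ef := (HolStr.trivial X).eventually_restrict_eq (s := f) (U := U) (fun _ h => h.1) hx
  rw [D.evalGerm_eq (hE.funSmul f' s') hx,
    D.evalGerm_eq s' hx ⟨s, hs⟩ (hE.eventually_restrict_eq _ hx), D.leibniz,
    show sectionDiff f' ⟨x, hx⟩ = cotangentDiff f x from cotangentDiff_congr ef]
  · rfl
  · exact eventually_extendZero_eq _ hx fun _ => rfl

/-- In $D(f\cdot gt)=f\,D(gt)+gt\otimes\phi^*(df)$ both terms vanish at `x`, the first because
$f(x)=0$ and the second because $g(x)=0$. -/
lemma evalGerm_eq_zero_of_mem_germsSq {x : X} {s : hE.germs x} (hs : s ∈ hE.germsSq x) :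
    D.evalGerm x s = 0 := by
  induction hs using Submodule.span_induction with
  | mem s h =>
    obtain ⟨f, g, t, hf, hg, ht, hf0, hg0, e⟩ := h
    rw [D.evalGerm_congr (t := ⟨_, hE.smul hf (hE.smul hg ht)⟩) e,
      D.evalGerm_funSmul hf (hE.smul hg ht), hf0, hg0, zero_smul, zero_smul,
      TensorProduct.zero_tmul, add_zero]
  | zero => exact map_zero _
  | add a b _ _ ha hb => rw [map_add, ha, hb, add_zero]
  | smul c a _ ha => rw [map_smul, ha, smul_zero]

/-- A connection as a homomorphism on first jets. -/
def evalJet (x : X) : JetFiber hE x →ₗ[ℂ] E x ⊗[ℂ] Module.Dual ℂ (V x) :=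
  (hE.germsSq x).liftQ (D.evalGerm x) fun _ hs => D.evalGerm_eq_zero_of_mem_germsSq hs

lemma evalJet_jet {x : X} {s : ∀ y, E y} (hs : hE.HolAt x s) :
    D.evalJet x (jet hE s x) = D.evalGerm x ⟨s, hs⟩ := by
  rw [jet_eq hE hs]; rfl

lemma evalJet_jet_extendZero {U : Opens X} (s : hE.sections U) (x : U) :
    D.evalJet x (jet hE (extendZero s.1) x) = (D.toFun U s).1 x := by
  rw [D.evalJet_jet (s.2 x)]
  exact D.evalGerm_eq s x.2 _ (Filter.Eventually.of_forall fun _ => rfl)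

lemma holAt_evalJet {x : X} {s : ∀ y, E y} (hs : hE.HolAt x s) :
    (hE.tensor hV.dual).HolAt x (fun y => D.evalJet y (jet hE s y)) := by
  let s' := hE.restrict (s := s) (hE.domain s) fun _ h => h
  refine (hE.tensor hV.dual).congr ((D.toFun _ s').2 ⟨x, hs⟩) ?_
  refine eventually_extendZero_eq _ hs fun y => ?_
  rw [D.evalJet_jet y.2]
  exact (D.evalGerm_eq s' y.2 _ (hE.eventually_restrict_eq _ y.2)).symm

end LieAlgebroidConnection

variable (F : Type*) [NormedAddCommGroup F] [NormedSpace ℂ F] [FiniteDimensional ℂ F]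
variable (E : X → Type*) [TopologicalSpace (Bundle.TotalSpace F E)] [∀ x, AddCommGroup (E x)]
variable [∀ x, Module ℂ (E x)] [∀ x, TopologicalSpace (E x)] [FiberBundle F E] [VectorBundle ℂ F E]
variable [ContMDiffVectorBundle ω F E 𝓘(ℂ)]

/-- The symbol of a connection is $\mathrm{id}\otimes\phi^*$: for $f(x)=0$ the Leibniz rule leaves
only $s(x)\otimes\phi^*(df_x)$. -/
lemma LieAlgebroidConnection.evalJet_jetSymbol
    (D : LieAlgebroidConnection L (HolStr.ofBundle F E)) (x : X)
    (u : E x ⊗[ℂ] Module.Dual ℂ (TangentSpace 𝓘(ℂ) x)) :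
    D.evalJet x (jetSymbol F E x u) = LinearMap.lTensor (E x) (L.coanchor x) u := by
  induction u with
  | zero => simp
  | add a b ha hb => rw [map_add, map_add, ha, hb, map_add]
  | tmul e w =>
    rw [jetSymbol_tmul, D.evalJet_jet ((HolStr.ofBundle F E).smul (holAt_linExt x w)
      (holAt_constExt F x e)), D.evalGerm_funSmul (holAt_linExt x w) (holAt_constExt F x e),
      linExt_self, zero_smul, zero_add, constExt_self, cotangentDiff_linExt,
      LinearMap.lTensor_tmul]

/-- The left inverse of `α'` that is given by a connection, `[(v, j¹s)] ↦ v + D s`. -/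
def LieAlgebroidConnection.toRetraction (D : LieAlgebroidConnection L (HolStr.ofBundle F E)) :
    HolRetraction ((HolStr.ofBundle F E).tensor hV.dual) (vJets F E L) (vJetIncl F E L) where
  toFun x := (LinearMap.range (jetDelta F E L x)).liftQ
    (LinearMap.coprod LinearMap.id (D.evalJet x)) (by
      rintro _ ⟨u, rfl⟩
      -- On the image of $\Delta$ the first component contributes $-(\mathrm{id}\otimes\phi^*)(u)$,
      -- which cancels the symbol of `D`.
      change -(LinearMap.lTensor (E x) (L.coanchor x) u) + D.evalJet x (jetSymbol F E x u) = 0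
      rw [D.evalJet_jetSymbol, neg_add_cancel])
  hol x σ hσ := by
    obtain ⟨v, s, hv, hs, e⟩ := (vJets_holAt_iff F E L).1 hσ
    refine HolStr.congr _ (HolStr.add _ hv (D.holAt_evalJet hs)) ?_
    filter_upwards [e] with y hy
    rw [hy]
    rfl
  left_inv x := by
    refine LinearMap.ext fun v => ?_
    change v + D.evalJet x 0 = v
    rw [map_zero, add_zero]

lemma LieAlgebroidConnection.toRetraction_vJetMk
    (D : LieAlgebroidConnection L (HolStr.ofBundle F E)) (x : X)
    (v : E x ⊗[ℂ] Module.Dual ℂ (V x)) (j : JetFiber (HolStr.ofBundle F E) x) :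
    (D.toRetraction F E).toFun x (vJetMk F E L x (v, j)) = v + D.evalJet x j := rfl

/-- The connection `D s = δ([(0, j¹s)])` that is given by a left inverse `δ` of `α'`. -/
def HolRetraction.toConnection
    (δ : HolRetraction ((HolStr.ofBundle F E).tensor hV.dual) (vJets F E L) (vJetIncl F E L)) :
    LieAlgebroidConnection L (HolStr.ofBundle F E) where
  toFun U :=
    { toFun := fun s =>
        ⟨fun x => δ.toFun x (vJetMk F E L x (0, jet (HolStr.ofBundle F E) (extendZero s.1) x)),
          fun x => by
            refine HolStr.congr _ (δ.hol x _ (vJets_vJetMk F E L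
              (((HolStr.ofBundle F E).tensor hV.dual).zero x)
              ((HolStr.ofBundle F E).jets_jet (s.2 x)))) ?_
            filter_upwards [U.isOpen.mem_nhds x.2] with y hy
            exact (extendZero_apply_mem (A := fun y => E y ⊗[ℂ] Module.Dual ℂ (V y)) (fun x : U => δ.toFun x (vJetMk F E L x
              (0, jet (HolStr.ofBundle F E) (extendZero s.1) x))) hy).symm⟩
      map_add' := fun s t => by
        refine Subtype.ext (funext fun x => ?_)
        change _ = δ.toFun x _ + δ.toFun x _
        rw [← map_add, ← vJetMk_add, ← jet_add _ (s.2 x) (t.2 x), ← extendZero_add, add_zero]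
        rfl
      map_smul' := fun c s => by
        refine Subtype.ext (funext fun x => ?_)
        change _ = c • δ.toFun x _
        rw [← map_smul, ← map_smul, Prod.smul_mk, smul_zero, ← jet_smul _ _ (s.2 x)]
        dsimp only
        rw [jet_congr]
        exact eventually_extendZero_eq _ x.2 fun y => by
          rw [extendZero_apply_mem s.1 y.2]; rfl }
  map_res h s := by
    refine Subtype.ext (funext fun x => ?_)
    change δ.toFun x (vJetMk F E L x (0, _)) = δ.toFun x (vJetMk F E L x (0, _))
    -- The extensions by zero from the two open sets may differ outside the smaller one, but they
    -- have the same germ at `x`.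
    rw [jet_congr (t := extendZero s.1)]
    exact eventually_extendZero_eq _ x.2 fun y => by
      rw [extendZero_apply_mem s.1 (h y.2)]; rfl
  leibniz U f s x := by
    change δ.toFun x (vJetMk F E L x (0, _)) = f.1 x • δ.toFun x (vJetMk F E L x (0, _)) + _
    have e : ∀ᶠ y in 𝓝 (x : X), extendZero ((HolStr.ofBundle F E).funSmul f s).1 y =
        extendZero (E := fun _ : X => ℂ) f.1 y • extendZero s.1 y :=
      eventually_extendZero_eq _ x.2 fun y => by
        rw [extendZero_apply_mem s.1 y.2, extendZero_apply_mem (A := fun _ : X => ℂ) f.1 y.2]; rfl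
    rw [jet_congr _ e, jet_funSmul F E (f.2 x) (s.2 x), extendZero_apply_mem s.1 x.2,
      extendZero_apply_mem (A := fun _ : X => ℂ) f.1 x.2, ← add_zero (0 : E x ⊗[ℂ] Module.Dual ℂ (V x)), vJetMk_add,
      vJetMk_jetSymbol, map_add, ← smul_zero (f.1 x), ← Prod.smul_mk, map_smul, map_smul,
      smul_zero]
    -- What remains is $\delta(\alpha'(s\otimes\phi^*(df)))=s\otimes\phi^*(df)$, the contribution of
    -- the symbol term of the jet.
    congr 1
    · exact LinearMap.congr_fun (δ.left_inv x) _

lemma HolRetraction.toConnection_apply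
    (δ : HolRetraction ((HolStr.ofBundle F E).tensor hV.dual) (vJets F E L) (vJetIncl F E L))
    {U : Opens X} (s : (HolStr.ofBundle F E).sections U) (x : U) :
    ((δ.toConnection F E).toFun U s).1 x =
      δ.toFun x (vJetMk F E L x (0, jet (HolStr.ofBundle F E) (extendZero s.1) x)) := rfl

/-- Connections on `E` are the same as left inverses of `α' : E ⊗ V^* → J¹_V(E)`. -/
def LieAlgebroidConnection.equivRetraction :
    LieAlgebroidConnection L (HolStr.ofBundle F E) ≃
      HolRetraction ((HolStr.ofBundle F E).tensor hV.dual) (vJets F E L) (vJetIncl F E L) where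
  toFun D := D.toRetraction F E
  invFun δ := δ.toConnection F E
  left_inv D := by
    refine LieAlgebroidConnection.ext (funext fun U => LinearMap.ext fun s =>
      Subtype.ext (funext fun x => ?_))
    rw [HolRetraction.toConnection_apply, D.toRetraction_vJetMk, zero_add,
      D.evalJet_jet_extendZero]
  right_inv δ := by
    refine HolRetraction.ext (funext fun x => LinearMap.ext fun σ => ?_)
    obtain ⟨⟨v, j⟩, rfl⟩ := vJetMk_surjective F E L x σ
    obtain ⟨s, hs, rfl⟩ := exists_jet_eq _ j
    let hE := HolStr.ofBundle F E
    -- An arbitrary jet is represented by a section over an honest open set, to which the formula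
    -- for the connection of `δ` applies.
    have e := hE.eventually_germSection_eq ⟨s, hs⟩
    rw [LieAlgebroidConnection.toRetraction_vJetMk, ← jet_congr _ e,
      LieAlgebroidConnection.evalJet_jet_extendZero _ (hE.germSection ⟨s, hs⟩) ⟨x, hs⟩,
      HolRetraction.toConnection_apply, vJetMk_eq F E L x v, map_add]
    congr 1
    exact (LinearMap.congr_fun (δ.left_inv x) v).symm

end Connections

/-- The fibres of a vector bundle of finite rank are finite-dimensional. -/
lemma finiteDimensional_fiber {B : Type*} [TopologicalSpace B] (F : Type*) [NormedAddCommGroup F]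
    [NormedSpace ℂ F] [FiniteDimensional ℂ F] (E : B → Type*)
    [TopologicalSpace (Bundle.TotalSpace F E)] [∀ x, AddCommGroup (E x)] [∀ x, Module ℂ (E x)]
    [∀ x, TopologicalSpace (E x)] [FiberBundle F E] [VectorBundle ℂ F E] (x : B) :
    FiniteDimensional ℂ (E x) :=
  ((trivializationAt F E x).continuousLinearEquivAt ℂ x
    (FiberBundle.mem_baseSet_trivializationAt' x)).toLinearEquiv.symm.finiteDimensional

/-! ### Local frames, the Atiyah sequence and its splittings -/

section AtiyahSequence

variable {X : Type*} [TopologicalSpace X] [ChartedSpace ℂ X] [IsManifold 𝓘(ℂ) ω X]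
variable (F : Type*) [NormedAddCommGroup F] [NormedSpace ℂ F] [FiniteDimensional ℂ F]
variable (E : X → Type*) [TopologicalSpace (Bundle.TotalSpace F E)] [∀ x, AddCommGroup (E x)]
variable [∀ x, Module ℂ (E x)] [∀ x, TopologicalSpace (E x)] [FiberBundle F E] [VectorBundle ℂ F E]
variable [ContMDiffVectorBundle ω F E 𝓘(ℂ)]

/-- A local frame of a vector bundle near a point, with its dual frame. -/
lemma exists_frame (x : X) : ∃ (n : ℕ) (e : Fin n → ∀ y, E y)
    (l : Fin n → ∀ y, Module.Dual ℂ (E y)), (∀ i, (HolStr.ofBundle F E).HolAt x (e i)) ∧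
      (∀ i, (HolStr.ofBundle F E).dual.HolAt x (l i)) ∧
      ∀ᶠ y in 𝓝 x, ∀ v : E y, ∑ i, l i y v • e i y = v := by
  let b := Module.finBasis ℂ F
  let T := trivializationAt F E x
  have hxT : x ∈ T.baseSet := FiberBundle.mem_baseSet_trivializationAt' x
  refine ⟨_, fun i => constExt F E x (T.symmL ℂ x (b i)),
    fun i => trivCoord F E x (LinearMap.toContinuousLinearMap (b.coord i)),
    fun i => holAt_constExt F x _, fun i => holAt_trivCoord F x _, ?_⟩
  filter_upwards [eventually_mem_baseSet (E := E) F x] with y hy v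
  have h : ∀ i, constExt F E x (T.symmL ℂ x (b i)) y = T.symmL ℂ y (b i) := by
    intro i
    simp only [constExt]
    rw [T.continuousLinearMapAt_symmL (R := ℂ) hxT]
  simp only [h, ← map_smul, ← map_sum]
  have hs : ∑ i, b.coord i (T.continuousLinearMapAt ℂ y v) • b i =
      T.continuousLinearMapAt ℂ y v := b.sum_repr _
  refine (congrArg (T.symmL ℂ y) hs).trans ?_
  exact T.symmL_continuousLinearMapAt (R := ℂ) hy v

lemma HolStr.hom_smulRight {G : X → Type*} [∀ x, AddCommGroup (G x)] [∀ x, Module ℂ (G x)]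
    {H : X → Type*} [∀ x, AddCommGroup (H x)] [∀ x, Module ℂ (H x)]
    {hG : HolStr G} {hH : HolStr H} {x : X} {l : ∀ y, Module.Dual ℂ (G y)} {s : ∀ y, H y}
    (hl : hG.dual.HolAt x l) (hs : hH.HolAt x s) :
    (hG.hom hH).HolAt x (fun y => (l y).smulRight (s y)) := by
  filter_upwards [hl, hH.eventually hs] with y hly hsy t ht
  exact hH.smul (hly t ht) hsy

/-- A function is holomorphic if its product with a nonvanishing holomorphic section is. -/
lemma holFunAt_of_smul {x : X} {c : X → ℂ} {s : ∀ y, E y}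
    (hs : (HolStr.ofBundle F E).HolAt x s) (h0 : s x ≠ 0)
    (hc : (HolStr.ofBundle F E).HolAt x (fun y => c y • s y)) : HolFunAt c x := by
  obtain ⟨n, e, l, -, hl, h⟩ := exists_frame F E x
  -- Some coordinate of `s` is nonzero at `x`; dividing the same coordinate of `c • s` by it
  -- recovers `c`.
  obtain ⟨i, hi⟩ : ∃ i, l i x (s x) ≠ 0 := by
    by_contra! hne
    refine h0 ?_
    rw [← h.self_of_nhds (s x)]
    exact Finset.sum_eq_zero fun i _ => by rw [hne i, zero_smul]
  have h1 : HolFunAt (fun y => l i y (s y)) x := (hl i).self_of_nhds s hs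
  have h2 : HolFunAt (fun y => l i y (c y • s y)) x := (hl i).self_of_nhds _ hc
  refine (h2.mul (h1.inv₀ hi)).congr_of_eventuallyEq ?_
  filter_upwards [h1.continuousAt.eventually_ne hi] with y hy
  simp only [Pi.mul_apply, map_smul, smul_eq_mul]
  rw [mul_assoc, mul_inv_cancel₀ hy, mul_one]

variable {V : X → Type*} [∀ x, AddCommGroup (V x)] [∀ x, Module ℂ (V x)] {hV : HolStr V}
variable (L : LieAlgebroid hV)

/-- This factors $\alpha''$ through the canonical map $\mathrm{End}(E)\otimes
V^*\to\mathrm{Hom}(E,E\otimes V^*)$, an isomorphism on fibres because $E$ has finite rank. -/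
lemma homIncl_apply (x : X) (u : (E x →ₗ[ℂ] E x) ⊗[ℂ] Module.Dual ℂ (V x)) (e : E x) :
    homIncl F E L x u e = vJetIncl F E L x
      (TensorProduct.rTensorHomToHomRTensor (.id ℂ) (E x) (E x) (Module.Dual ℂ (V x)) u e) := by
  induction u with
  | zero => simp
  | add a b ha hb => simp only [map_add, LinearMap.add_apply, ha, hb]
  | tmul T θ => rfl

lemma homIncl_injective (x : X) : Function.Injective (homIncl F E L x) := by
  have := finiteDimensional_fiber F E x
  intro u u' h
  refine (rTensorHomEquivHomRTensor ℂ (E x) (E x) (Module.Dual ℂ (V x))).injective ?_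
  refine LinearMap.ext fun e => vJetIncl_injective F E L x ?_
  rw [rTensorHomEquivHomRTensor_apply, rTensorHomEquivHomRTensor_apply, ← homIncl_apply,
    ← homIncl_apply, h]

/-- A family of maps into the kernel of `β'` comes from `End(E) ⊗ V^*`. -/
lemma exists_homIncl_eq (x : X) {ψ : E x →ₗ[ℂ] VJetFiber F E L x}
    (h : homProj F E L x ψ = 0) : ∃ u, homIncl F E L x u = ψ := by
  have := finiteDimensional_fiber F E x
  have hr : ∀ e, ψ e ∈ LinearMap.range (vJetIncl F E L x) := fun e =>
    (exact_vJetIncl_vJetProj F E L x _).1 (LinearMap.congr_fun h e)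
  let q := LinearEquiv.ofInjective _ (vJetIncl_injective F E L x)
  -- This is `ψ` regarded as a map $E_x\to E_x\otimes V_x^*$, by inverting $\alpha'$ on its image.
  let χ := q.symm.toLinearMap ∘ₗ LinearMap.codRestrict _ ψ hr
  refine ⟨(rTensorHomEquivHomRTensor ℂ (E x) (E x) (Module.Dual ℂ (V x))).symm χ, ?_⟩
  refine LinearMap.ext fun e => ?_
  rw [homIncl_apply, ← rTensorHomEquivHomRTensor_apply, LinearEquiv.apply_symm_apply]
  exact congrArg Subtype.val (q.apply_symm_apply (LinearMap.codRestrict _ ψ hr e))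

lemma holAt_homIncl {x : X} {u : ∀ y, (E y →ₗ[ℂ] E y) ⊗[ℂ] Module.Dual ℂ (V y)}
    (hu : (((HolStr.ofBundle F E).hom (HolStr.ofBundle F E)).tensor hV.dual).HolAt x u) :
    ((HolStr.ofBundle F E).hom (vJets F E L)).HolAt x (fun y => homIncl F E L y (u y)) := by
  refine HolStr.generate_map ?_ hu
  rintro _ ⟨T, θ, hT, hθ, rfl⟩
  filter_upwards [hT, hV.dual.eventually hθ] with y hTy hθy s hs
  exact (isHolShortExact_vJets F E L).hol_left y _
    (HolStr.tensor_tmul _ _ (hTy s hs) hθy)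

/-- A holomorphic section of `E ⊗ V^*` and one of `E^*` give one of `End(E) ⊗ V^*`. -/
lemma exists_holAt_homIncl_eq_smulRight {x : X} {v : ∀ y, E y ⊗[ℂ] Module.Dual ℂ (V y)}
    {l : ∀ y, Module.Dual ℂ (E y)} (hv : ((HolStr.ofBundle F E).tensor hV.dual).HolAt x v)
    (hl : (HolStr.ofBundle F E).dual.HolAt x l) :
    ∃ u, (((HolStr.ofBundle F E).hom (HolStr.ofBundle F E)).tensor hV.dual).HolAt x u ∧
      ∀ y, ∀ e : E y, homIncl F E L y (u y) e = l y e • vJetIncl F E L y (v y) := by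
  -- On pure tensors $s\otimes\theta\mapsto(e\mapsto l(e)s)\otimes\theta$.
  let T : ∀ y, E y ⊗[ℂ] Module.Dual ℂ (V y) →ₗ[ℂ] (E y →ₗ[ℂ] E y) ⊗[ℂ] Module.Dual ℂ (V y) :=
    fun y => LinearMap.rTensor _ (LinearMap.smulRightₗ (l y))
  refine ⟨fun y => T y (v y), HolStr.generate_map ?_ hv, fun y e => ?_⟩
  · rintro _ ⟨s, θ, hs, hθ, rfl⟩
    exact HolStr.tensor_tmul _ _ (HolStr.hom_smulRight hl hs) hθ
  · rw [homIncl_apply, ← map_smul]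
    congr 1
    dsimp only
    generalize v y = w
    induction w with
    | zero => simp
    | add a b ha hb => rw [map_add, map_add, LinearMap.add_apply, ha, hb, smul_add]
    | tmul s θ => rfl

lemma homProj_coe (hE : ∀ x, Nontrivial (E x)) (x : X) (ψ : atiyahFiber F E L x) :
    homProj F E L x ψ = atiyahProj F E L hE x ψ • (LinearMap.id : E x →ₗ[ℂ] E x) := by
  have := hE x
  exact (LinearEquiv.coord_apply_smul ℂ (E x →ₗ[ℂ] E x) LinearMap.id
      (one_ne_zero : (1 : Module.End ℂ (E x)) ≠ 0)
      ((homProj F E L x).restrict (fun _ h => h) ψ)).symm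

lemma vJetProj_atiyahFiber (hE : ∀ x, Nontrivial (E x)) (x : X) (ψ : atiyahFiber F E L x)
    (e : E x) : vJetProj F E L x (ψ.1 e) = atiyahProj F E L hE x ψ • e :=
  LinearMap.congr_fun (homProj_coe F E L hE x ψ) e

lemma atiyahProj_eq_of_vJetProj (hE : ∀ x, Nontrivial (E x)) {x : X} {ψ : atiyahFiber F E L x}
    {c : ℂ} (h : ∀ e, vJetProj F E L x (ψ.1 e) = c • e) : atiyahProj F E L hE x ψ = c := by
  have := hE x
  obtain ⟨e, he⟩ := exists_ne (0 : E x)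
  exact smul_left_injective ℂ he ((vJetProj_atiyahFiber F E L hE x ψ e).symm.trans (h e))

lemma mem_atiyahFiber {x : X} {ψ : E x →ₗ[ℂ] VJetFiber F E L x} {c : ℂ}
    (h : ∀ e, vJetProj F E L x (ψ e) = c • e) : ψ ∈ atiyahFiber F E L x :=
  Submodule.mem_span_singleton.2 ⟨c, LinearMap.ext fun e => (h e).symm⟩

/-- Applying `ψ` to a holomorphic section $s$ with $s(x)\ne0$ and then $\beta'$ gives the
holomorphic section $\hat\beta(\psi)s$, which can be divided by $s$. -/
lemma holAt_atiyahProj (hE : ∀ x, Nontrivial (E x)) {x : X} {ψ : ∀ y, atiyahFiber F E L y}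
    (hψ : (atiyahBundle F E L).HolAt x ψ) :
    HolFunAt (fun y => atiyahProj F E L hE y (ψ y)) x := by
  have := hE x
  obtain ⟨e, he⟩ := exists_ne (0 : E x)
  have hs := holAt_constExt F x e
  refine holFunAt_of_smul F E hs (by rwa [constExt_self]) ?_
  have h : (vJets F E L).HolAt x (fun y => (ψ y).1 (constExt F E x e y)) :=
    hψ.self_of_nhds _ hs
  refine (HolStr.ofBundle F E).congr ((isHolShortExact_vJets F E L).hol_right x _ h) ?_
  exact Filter.Eventually.of_forall fun y => vJetProj_atiyahFiber F E L hE y _ _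

/-- Local holomorphic splittings of `0 → E ⊗ V^* → J¹_V(E) → E → 0`. -/
lemma exists_local_splitting (x : X) : ∃ φ : ∀ y, E y →ₗ[ℂ] VJetFiber F E L y,
    ((HolStr.ofBundle F E).hom (vJets F E L)).HolAt x φ ∧
      ∀ᶠ y in 𝓝 x, ∀ e, vJetProj F E L y (φ y e) = e := by
  obtain ⟨n, e, l, he, hl, h⟩ := exists_frame F E x
  choose σ hσ hσe using fun i => (isHolShortExact_vJets F E L).surjective_sections x _ (he i)
  -- Each member of the frame is lifted to $J^1_V(E)$, and the lifts $\sigma_i$ are extended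
  -- linearly by means of the dual frame.
  refine ⟨fun y => ∑ i, (l i y).smulRight (σ i y),
    HolStr.sum _ _ fun i _ => HolStr.hom_smulRight (hl i) (hσ i), ?_⟩
  filter_upwards [h, Filter.eventually_all.2 hσe] with y hy hy' v
  rw [LinearMap.sum_apply, map_sum]
  simp only [LinearMap.smulRight_apply, map_smul, hy']
  exact hy v

lemma atiyahProj_surjective (hE : ∀ x, Nontrivial (E x)) (x : X) :
    Function.Surjective (atiyahProj F E L hE x) := by
  intro c
  obtain ⟨φ, -, hφ⟩ := exists_local_splitting F E L x
  have h : ∀ e, vJetProj F E L x ((c • φ x) e) = c • e := fun e => by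
    rw [LinearMap.smul_apply, map_smul, hφ.self_of_nhds]
  exact ⟨⟨_, mem_atiyahFiber F E L h⟩, atiyahProj_eq_of_vJetProj F E L hE h⟩

lemma atiyahProj_atiyahIncl (hE : ∀ x, Nontrivial (E x)) (x : X)
    (u : (E x →ₗ[ℂ] E x) ⊗[ℂ] Module.Dual ℂ (V x)) :
    atiyahProj F E L hE x (atiyahIncl F E L x u) = 0 :=
  atiyahProj_eq_of_vJetProj F E L hE fun e => by
    rw [zero_smul]
    exact LinearMap.congr_fun (homProj_homIncl F E L x u) e

/-- Since $\beta'\circ\psi=0$, each $\psi(e_i)$ is $\alpha'(v_i)$ with $v_i$ holomorphic. The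
section of $\mathrm{End}(E)\otimes V^*$ assembled from the $v_i$ and the dual frame then maps to
$\psi=\sum_i l_i\otimes\psi(e_i)$. -/
lemma exists_atiyahIncl_eq_of_holAt (hE : ∀ x, Nontrivial (E x)) {x : X}
    {ψ : ∀ y, atiyahFiber F E L y} (hψ : (atiyahBundle F E L).HolAt x ψ)
    (h0 : ∀ᶠ y in 𝓝 x, atiyahProj F E L hE y (ψ y) = 0) :
    ∃ u, (((HolStr.ofBundle F E).hom (HolStr.ofBundle F E)).tensor hV.dual).HolAt x u ∧
      ∀ᶠ y in 𝓝 x, atiyahIncl F E L y (u y) = ψ y := by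
  obtain ⟨n, e, l, he, hl, h⟩ := exists_frame F E x
  have h1 : ∀ i, (vJets F E L).HolAt x (fun y => (ψ y).1 (e i y)) := fun i =>
    hψ.self_of_nhds _ (he i)
  have h2 : ∀ i, ∀ᶠ y in 𝓝 x, vJetProj F E L y ((ψ y).1 (e i y)) = 0 := fun i => by
    filter_upwards [h0] with y hy
    rw [vJetProj_atiyahFiber F E L hE, hy, zero_smul]
  choose v hv hve using fun i =>
    (isHolShortExact_vJets F E L).exact_sections x _ (h1 i) (h2 i)
  choose u hu hue using fun i => exists_holAt_homIncl_eq_smulRight F E L (hv i) (hl i)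
  refine ⟨fun y => ∑ i, u i y, HolStr.sum _ _ fun i _ => hu i, ?_⟩
  filter_upwards [h, Filter.eventually_all.2 hve] with y hy hy'
  refine Subtype.ext (LinearMap.ext fun w => ?_)
  change homIncl F E L y (∑ i, u i y) w = _
  rw [map_sum, LinearMap.sum_apply]
  simp only [hue, hy', ← map_smul, ← map_sum]
  rw [hy w]

/-- The sequence `0 → End(E) ⊗ V^* → A_V(E) → O_X → 0` is exact. -/
theorem isHolShortExact_atiyahBundle (hE : ∀ x, Nontrivial (E x)) :
    IsHolShortExact (((HolStr.ofBundle F E).hom (HolStr.ofBundle F E)).tensor hV.dual)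
      (atiyahBundle F E L) (HolStr.trivial X) (atiyahIncl F E L) (atiyahProj F E L hE) where
  hol_left x u hu := holAt_homIncl F E L hu
  hol_right x ψ hψ := holAt_atiyahProj F E L hE hψ
  injective x u u' h := homIncl_injective F E L x (congrArg Subtype.val h)
  exact x ψ := by
    constructor
    · intro h
      obtain ⟨u, hu⟩ := exists_homIncl_eq F E L x (ψ := ψ.1) (by
        rw [homProj_coe F E L hE, h, zero_smul])
      exact ⟨u, Subtype.ext hu⟩
    · rintro ⟨u, rfl⟩
      exact atiyahProj_atiyahIncl F E L hE x u
  surjective := atiyahProj_surjective F E L hE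
  exact_sections x ψ hψ h0 := exists_atiyahIncl_eq_of_holAt F E L hE hψ h0
  surjective_sections x c hc := by
    classical
    obtain ⟨φ, hφ, hφe⟩ := exists_local_splitting F E L x
    have hp : ∀ᶠ y in 𝓝 x, ∀ e, vJetProj F E L y ((c y • φ y) e) = c y • e := by
      filter_upwards [hφe] with y hy e
      rw [LinearMap.smul_apply, map_smul, hy]
    -- The local splitting is only controlled near `x`, so `c y • φ y` may leave $A_V(E)$ elsewhere;
    -- the value `0` there does not affect the germ.
    let ψ : ∀ y, atiyahFiber F E L y := fun y =>
      if h : c y • φ y ∈ atiyahFiber F E L y then ⟨_, h⟩ else 0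
    have hψ : ∀ᶠ y in 𝓝 x, c y • φ y = (ψ y).1 := by
      filter_upwards [hp] with y hy
      simp only [ψ, dif_pos (mem_atiyahFiber F E L hy)]
    refine ⟨ψ, ((HolStr.ofBundle F E).hom (vJets F E L)).congr (HolStr.smul _ hc hφ) hψ, ?_⟩
    filter_upwards [hp, hψ] with y hy hy'
    exact atiyahProj_eq_of_vJetProj F E L hE fun e => by rw [← hy', hy]

/-- Splittings of `J¹_V(E) → E` are the same as splittings of `A_V(E) → O_X`. -/
def HolSplitting.equivAtiyah (hE : ∀ x, Nontrivial (E x)) :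
    HolSplitting (vJets F E L) (HolStr.ofBundle F E) (vJetProj F E L) ≃
      HolSplitting (atiyahBundle F E L) (HolStr.trivial X) (atiyahProj F E L hE) where
  toFun φ :=
    have hφ : ∀ x (c : ℂ) e, vJetProj F E L x ((c • φ.toFun x) e) = c • e := fun x c e => by
      rw [LinearMap.smul_apply, map_smul]
      exact congrArg (c • ·) (LinearMap.congr_fun (φ.right_inv x) e)
    { toFun := fun x => LinearMap.toSpanSingleton ℂ (atiyahFiber F E L x)
        ⟨φ.toFun x, mem_atiyahFiber F E L (c := 1) fun e => by
          have := hφ x 1 e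
          rwa [one_smul] at this⟩
      hol := fun x c hc => ((HolStr.ofBundle F E).hom (vJets F E L)).smul hc
        (Filter.Eventually.of_forall fun y s hs => φ.hol y s hs)
      right_inv := fun x => LinearMap.ext fun c =>
        atiyahProj_eq_of_vJetProj F E L hE fun e => hφ x c e }
  invFun ψ :=
    { toFun := fun x => (ψ.toFun x 1).1
      hol := fun x s hs => by
        have h : (atiyahBundle F E L).HolAt x (fun y => ψ.toFun y 1) :=
          ψ.hol x _ contMDiffAt_const
        exact h.self_of_nhds s hs
      right_inv := fun x => LinearMap.ext fun e => by
        have h : atiyahProj F E L hE x (ψ.toFun x 1) = 1 :=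
          LinearMap.congr_fun (ψ.right_inv x) 1
        rw [LinearMap.comp_apply, vJetProj_atiyahFiber F E L hE, h, one_smul, LinearMap.id_apply] }
  left_inv φ := HolSplitting.ext (funext fun x => one_smul ℂ (φ.toFun x))
  right_inv ψ := by
    -- A linear map out of `ℂ` is determined by its value at `1`.
    refine HolSplitting.ext (funext fun x => LinearMap.ext_ring ?_)
    exact Subtype.ext (one_smul ℂ (ψ.toFun x 1).1)

lemma HolSplitting.equivAtiyah_apply (hE : ∀ x, Nontrivial (E x))
    (φ : HolSplitting (vJets F E L) (HolStr.ofBundle F E) (vJetProj F E L)) (x : X) (c : ℂ)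
    (e : E x) : ((HolSplitting.equivAtiyah F E L hE φ).toFun x c).1 e = c • φ.toFun x e := rfl

end AtiyahSequence

end

theorem lemma2p2 {X : Type*} [TopologicalSpace X] [T2Space X] [CompactSpace X] [ConnectedSpace X]
    [ChartedSpace ℂ X] [IsManifold 𝓘(ℂ) ω X]
    -- the Lie algebroid
    (FV : Type*) [NormedAddCommGroup FV] [NormedSpace ℂ FV] [FiniteDimensional ℂ FV]
    (V : X → Type*) [TopologicalSpace (Bundle.TotalSpace FV V)] [∀ x, AddCommGroup (V x)]
    [∀ x, Module ℂ (V x)] [∀ x, TopologicalSpace (V x)] [FiberBundle FV V] [VectorBundle ℂ FV V]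
    [ContMDiffVectorBundle ω FV V 𝓘(ℂ)]
    (L : LieAlgebroid (HolStr.ofBundle FV V))
    -- the vector bundle
    (F : Type*) [NormedAddCommGroup F] [NormedSpace ℂ F] [FiniteDimensional ℂ F]
    (E : X → Type*) [TopologicalSpace (Bundle.TotalSpace F E)] [∀ x, AddCommGroup (E x)]
    [∀ x, Module ℂ (E x)] [∀ x, TopologicalSpace (E x)] [FiberBundle F E] [VectorBundle ℂ F E]
    [ContMDiffVectorBundle ω F E 𝓘(ℂ)] :
    -- the sequence `0 → E ⊗ V^* → J¹_V(E) → E → 0` is exact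
    IsHolShortExact ((HolStr.ofBundle F E).tensor (HolStr.ofBundle FV V).dual) (vJets F E L)
      (HolStr.ofBundle F E) (vJetIncl F E L) (vJetProj F E L) ∧
    -- connections correspond to its splittings, given by right inverses or by left inverses
    ∃ (Ψ : LieAlgebroidConnection L (HolStr.ofBundle F E) ≃
          HolSplitting (vJets F E L) (HolStr.ofBundle F E) (vJetProj F E L))
      (Θ : LieAlgebroidConnection L (HolStr.ofBundle F E) ≃
          HolRetraction ((HolStr.ofBundle F E).tensor (HolStr.ofBundle FV V).dual) (vJets F E L)
            (vJetIncl F E L)),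
      (∀ D (U : Opens X) (s : (HolStr.ofBundle F E).sections U) (x : U),
        (Ψ D).toFun x (s.1 x) =
          vJetMk F E L x (-(D.toFun U s).1 x, jet (HolStr.ofBundle F E) (extendZero s.1) x)) ∧
      (∀ D (U : Opens X) (s : (HolStr.ofBundle F E).sections U) (x : U)
        (v : E x ⊗[ℂ] Module.Dual ℂ (V x)),
        (Θ D).toFun x
            (vJetMk F E L x (v, jet (HolStr.ofBundle F E) (extendZero s.1) x)) =
          v + (D.toFun U s).1 x) ∧
      -- for `E` of positive rank, the sequence `0 → End(E) ⊗ V^* → A_V(E) → O_X → 0` is exact and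
      -- connections correspond to its splittings
      ∀ hE : ∀ x, Nontrivial (E x),
        IsHolShortExact
          (((HolStr.ofBundle F E).hom (HolStr.ofBundle F E)).tensor (HolStr.ofBundle FV V).dual)
          (atiyahBundle F E L) (HolStr.trivial X) (atiyahIncl F E L) (atiyahProj F E L hE) ∧
        ∃ Φ : LieAlgebroidConnection L (HolStr.ofBundle F E) ≃
            HolSplitting (atiyahBundle F E L) (HolStr.trivial X) (atiyahProj F E L hE),
          ∀ D x (c : ℂ) (e : E x),
            ((Φ D).toFun x c : E x →ₗ[ℂ] VJetFiber F E L x) e = c • (Ψ D).toFun x e := by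
  have h := isHolShortExact_vJets F E L
  let Θ := LieAlgebroidConnection.equivRetraction (L := L) F E
  let Ψ := Θ.trans (HolRetraction.equivSplitting h)
  refine ⟨h, Ψ, Θ, fun D U s x => ?_, fun D U s x v => ?_, fun hE =>
    ⟨isHolShortExact_atiyahBundle F E L hE, Ψ.trans (HolSplitting.equivAtiyah F E L hE),
      fun D x c e => HolSplitting.equivAtiyah_apply F E L hE (Ψ D) x c e⟩⟩
  -- The vector $s(x)$ is lifted to $[(0,j^1_xs)]$, at which
  -- $\varphi\circ\beta'=\mathrm{Id}-\alpha'\circ\delta$ takes the value $[(-D(s)(x),j^1_xs)]$.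
  · have hs : s.1 x = vJetProj F E L x
        (vJetMk F E L x (0, jet (HolStr.ofBundle F E) (extendZero s.1) x)) := by
      rw [vJetProj_vJetMk, jetEval_jet _ (s.2 x)]
      exact (extendZero_apply_mem s.1 x.2).symm
    have hΨ := HolRetraction.equivSplitting_apply h (Θ D) x
      (vJetMk F E L x (0, jet (HolStr.ofBundle F E) (extendZero s.1) x))
    rw [← hs] at hΨ
    refine hΨ.trans ?_
    rw [show (Θ D).toFun x (vJetMk F E L x (0, _)) = 0 + _ from D.toRetraction_vJetMk F E x _ _,
      D.evalJet_jet_extendZero, zero_add, vJetMk_eq F E L x (-_), map_neg, sub_eq_neg_add]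
  · refine (D.toRetraction_vJetMk F E x _ _).trans ?_
    rw [D.evalJet_jet_extendZero]
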